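/- Let $n\ge 2$ and let $G$ be a compact group (for instance a compact Lie group) acting on $\mathbb R^L$ through a continuous orthogonal representation. Let $M\subset\mathbb R^L$ be a compact $G$-invariant smooth embedded $(n+1)$-dimensional submanifold with (possibly empty) boundary $\partial M$ and the induced metric. (By the equivariant isometric embedding theorem every compact Riemannian manifold with an isometric action of a compact Lie group is of this form.) Let $U\subset M$ be relatively open and $G$-invariant, and let $(\Sigma,\partial\Sigma)\subset(U,U\cap\partial M)$ be an almost properly embedded $G$-hypersurface: $\Sigma$ is a $G$-invariant smooth embedded $n$-dimensional submanifold with (possibly empty) boundary $\partial \Sigma$, with $\Sigma\subset U$ and $\partial\Sigma\subset U\cap\partial M$ (the interior of $\Sigma$ may touch $\partial M$). Let $\mathfrak X(M,\Sigma)$ be the space of smooth vector fields $X$ on $\mathbb R^L$ with $X(p)\in T_pM$ for all $p\in M$ and $X(q)\in T_q(\partial M)$ for all $q$ in an open neighbourhood of $\partial\Sigma$ in $\partial M$, and let $\mathfrak X^G(M,\Sigma)$ be the subspace of those with $g_*X=X$ for all $g\in G$. We call $X$ compactly supported in $U$ if the closure $\operatorname{spt}_M X$ of $\{p\in M: X(p)\ne0\}$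 is a compact subset of $U$ and $\Sigma\cap\operatorname{spt}_M X$ is compact (the last condition is automatic if $\Sigma$ is relatively closed in $U$). The first variation is $\delta\Sigma(X)=\int_\Sigma \operatorname{div}_\Sigma X\,d\mathcal H^n$. For a smooth unit normal field $\nu$ of $\Sigma$ in $M$ and $X=f\nu$ on $\Sigma$, the second variation is $$\delta^2\Sigma(X)=\int_\Sigma |\nabla^\Sigma f|^2-\big(\operatorname{Ric}_M(\nu,\nu)+|A^\Sigma|^2\big)f^2\,d\mathcal H^n-\int_{\partial\Sigma}h(\nu,\nu)f^2\,d\mathcal H^{n-1},$$ where $A^\Sigma$ is the second fundamental form of $\Sigma$ in $M$ and $h$ is that of $\partial M$ with respect to the inward unit normal. $\Sigma$ is *stationary* (resp. *$G$-stationary*) in $U$ if $\delta\Sigma(X)=0$ for all $X\in\mathfrak X(M,\Sigma)$ (resp. $X\in\mathfrak X^G(M,\Sigma)$) compactly supported in $U$. $\Sigma$ is *stable in $U$* if it is stationary in $U$ and has a smooth unit normal $\nu$ such that $\delta^2\Sigma(X)\ge0$ for all $X\in\mathfrak X(M,\Sigma)$ compactly supported in $U$ with $X=f\nu$ on $\Sigma$.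 $\Sigma$ is *$G$-stable in $U$* if it is $G$-stationary in $U$ and has a smooth $G$-invariant unit normal $\nu$ such that $\delta^2\Sigma(X)\ge0$ for all $X\in\mathfrak X^G(M,\Sigma)$ compactly supported in $U$ with $X=f\nu$ on $\Sigma$. Then: 1. $\Sigma$ is $G$-stationary in $U$ if and only if it is stationary in $U$. 2. $\Sigma$ is $G$-stable in $U$ if and only if it has a smooth $G$-invariant unit normal vector field and is stable in $U$. -/

import Mathlib

open MeasureTheory
open scoped ContDiff

namespace EquivariantStability

/-- The ambient Euclidean space `ℝ^L`. -/
abbrev E (L : ℕ) := EuclideanSpace ℝ (Fin L)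

/-! ### Embedded submanifolds with boundary, tangent spaces, tangential calculus -/

/-- The coordinate slice `ℝ^k × {0}` of `ℝ^L`. -/
def slice (L k : ℕ) : Set (E L) := {y | ∀ i : Fin L, k ≤ (i : ℕ) → y i = 0}

/-- The coordinate half slice `{y ∈ ℝ^k × {0} : y₀ ≥ 0}`. -/
def halfSlice (L k : ℕ) : Set (E L) :=
  {y | y ∈ slice L k ∧ ∀ i : Fin L, (i : ℕ) = 0 → 0 ≤ y i}

/-- The edge `{y ∈ ℝ^k × {0} : y₀ = 0}` of the half slice. -/
def sliceEdge (L k : ℕ) : Set (E L) :=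
  {y | y ∈ slice L k ∧ ∀ i : Fin L, (i : ℕ) = 0 → y i = 0}

/-- `S ⊆ ℝ^L` is a smooth embedded `k`-dimensional submanifold with (possibly empty) manifold
boundary `B`: near each of its points an ambient smooth chart maps the pair `(S, B)` either to
`(slice, ∅)` or to `(half slice, edge)`. `S` need not be closed in `ℝ^L`. -/
structure IsSubmanifoldWithBoundary {L : ℕ} (k : ℕ) (S B : Set (E L)) : Prop where
  dim_pos : 0 < k
  dim_le : k ≤ L
  boundary_subset : B ⊆ S
  exists_chart : ∀ p ∈ S, ∃ e : OpenPartialHomeomorph (E L) (E L), p ∈ e.source ∧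
    ContDiffOn ℝ ∞ e e.source ∧ ContDiffOn ℝ ∞ e.symm e.target ∧
    ((∀ x ∈ e.source, (x ∈ S ↔ e x ∈ slice L k) ∧ x ∉ B) ∨
     (∀ x ∈ e.source, (x ∈ S ↔ e x ∈ halfSlice L k) ∧ (x ∈ B ↔ e x ∈ sliceEdge L k)))

/-- The tangent space `T_p S` (at a boundary point it is the full `k`-dimensional tangent space,
not a half space). -/
noncomputable def tangentSp {L : ℕ} (S : Set (E L)) (p : E L) : Submodule ℝ (E L) :=
  Submodule.span ℝ (tangentConeAt ℝ S p)

/-- The orthogonal projection of `ℝ^L` onto `T_p S`. -/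
noncomputable def tangentProj {L : ℕ} (S : Set (E L)) (p : E L) : E L →L[ℝ] E L :=
  (tangentSp S p).starProjection

/-- The derivative at `p ∈ S` of a vector-valued function `F` on `S` along tangent vectors of `S`;
normal components of the argument are discarded. Only the values of `F` on `S` matter, and
for `F` differentiable within `S` all derivatives of `F` within `S` agree on `T_p S`. -/
noncomputable def tangentialDeriv {L : ℕ} {W : Type*} [NormedAddCommGroup W] [NormedSpace ℝ W]
    (S : Set (E L)) (F : E L → W) (p : E L) : E L →L[ℝ] W :=
  (fderivWithin ℝ F S p) ∘L (tangentProj S p)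

/-! ### Curvature of submanifolds with the metric induced from `ℝ^L` -/

/-- The Levi-Civita connection `∇_V W` of the induced metric of `M`: the tangential part of the
derivative of `W` along `V`. -/
noncomputable def covDeriv {L : ℕ} (M : Set (E L)) (V W : E L → E L) (p : E L) : E L :=
  tangentProj M p (tangentialDeriv M W p (V p))

/-- The Lie bracket `[V, W]` of tangent vector fields on `M`. -/
noncomputable def bracket {L : ℕ} (M : Set (E L)) (V W : E L → E L) (p : E L) : E L :=
  tangentialDeriv M W p (V p) - tangentialDeriv M V p (W p)

/-- The tangent vector field `q ↦ P_q v` on `M`, which extends a vector `v ∈ T_p M`. -/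
noncomputable def tangentExtension {L : ℕ} (M : Set (E L)) (v : E L) (q : E L) : E L :=
  tangentProj M q v

/-- The Riemann curvature tensor
`R(x, y)z = ∇_x ∇_y z - ∇_y ∇_x z - ∇_[x,y] z` of `M` at `p`, for `x, y, z ∈ T_p M`. -/
noncomputable def riemann {L : ℕ} (M : Set (E L)) (p x y z : E L) : E L :=
  let X := tangentExtension M x
  let Y := tangentExtension M y
  let Z := tangentExtension M z
  covDeriv M X (covDeriv M Y Z) p - covDeriv M Y (covDeriv M X Z) p
    - covDeriv M (bracket M X Y) Z p

/-- The Ricci curvature `Ric_M(v, w) = tr (x ↦ R(x, v)w)` at `p`. -/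
noncomputable def ricci {L : ℕ} (M : Set (E L)) (p v w : E L) : ℝ :=
  ∑ i, inner ℝ (riemann M p (stdOrthonormalBasis ℝ (tangentSp M p) i) v w)
    (stdOrthonormalBasis ℝ (tangentSp M p) i : E L)

/-- The second fundamental form `(v, w) ↦ ⟨∇_v w, ν⟩ = -⟨D_v ν, w⟩` at `p` of a hypersurface `S`
(of some ambient submanifold) with respect to a unit normal field `ν` along `S`. -/
noncomputable def secondForm {L : ℕ} (S : Set (E L)) (ν : E L → E L) (p v w : E L) : ℝ :=
  -inner ℝ (tangentialDeriv S ν p v) w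

/-- The squared norm `|A|²` of the second fundamental form. -/
noncomputable def secondFormNormSq {L : ℕ} (S : Set (E L)) (ν : E L → E L) (p : E L) : ℝ :=
  ∑ i, ∑ j, (secondForm S ν p (stdOrthonormalBasis ℝ (tangentSp S p) i)
    (stdOrthonormalBasis ℝ (tangentSp S p) j)) ^ 2

/-- `ν` is a smooth unit normal vector field along the hypersurface `S` of `M`. -/
structure IsUnitNormal {L : ℕ} (M S : Set (E L)) (ν : E L → E L) : Prop where
  smooth : ContDiffOn ℝ ∞ ν S
  norm_eq : ∀ p ∈ S, ‖ν p‖ = 1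
  mem_tangent : ∀ p ∈ S, ν p ∈ tangentSp M p
  orthogonal : ∀ p ∈ S, ∀ v ∈ tangentSp S p, inner ℝ (ν p) v = 0

/-- `n` is the unit vector of `T_p M` that is normal to the boundary `dM` of `M` at `p ∈ dM` and
points into `M`. -/
def IsInwardUnitNormalAt {L : ℕ} (M dM : Set (E L)) (p n : E L) : Prop :=
  ‖n‖ = 1 ∧ n ∈ tangentSp M p ∧ (∀ v ∈ tangentSp dM p, inner ℝ n v = 0) ∧
    n ∈ posTangentConeAt M p

/-- The inward unit normal `ν_{∂M}` of `dM = ∂M` with respect to `M`. -/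
noncomputable def inwardUnitNormal {L : ℕ} (M dM : Set (E L)) (p : E L) : E L :=
  Classical.epsilon (IsInwardUnitNormalAt M dM p)

/-! ### First and second variation -/

/-- The divergence `div_S X = ∑ ⟨D_{e_i} X, e_i⟩` along `S`, over an orthonormal basis `e_i` of
`T_p S`. -/
noncomputable def surfaceDiv {L : ℕ} (S : Set (E L)) (X : E L → E L) (p : E L) : ℝ :=
  ∑ i, inner ℝ (fderiv ℝ X p (stdOrthonormalBasis ℝ (tangentSp S p) i))
    (stdOrthonormalBasis ℝ (tangentSp S p) i : E L)

/-- The first variation of area of the `n`-dimensional `S` along `X`,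
`δS(X) = ∫_S div_S X dℋⁿ`. -/
noncomputable def firstVariation {L : ℕ} (n : ℕ) (S : Set (E L)) (X : E L → E L) : ℝ :=
  ∫ p in S, surfaceDiv S X p ∂(μHE[n] : Measure (E L))

/-- The second variation of area along `X = f ν`, for a hypersurface `S` of dimension `n` with
boundary `dS` in `M`:
`∫_S |∇f|² - (Ric_M(ν,ν) + |A|²) f² dℋⁿ - ∫_{∂S} h(ν,ν) f² dℋⁿ⁻¹`,
with `h` the second fundamental form of `dM = ∂M` with respect to the inward unit normal. -/
noncomputable def secondVariation {L : ℕ} (n : ℕ) (M dM S dS : Set (E L)) (ν : E L → E L)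
    (f : E L → ℝ) : ℝ :=
  (∫ p in S, (‖tangentialDeriv S f p‖ ^ 2
      - (ricci M p (ν p) (ν p) + secondFormNormSq S ν p) * f p ^ 2) ∂(μHE[n] : Measure (E L)))
  - ∫ p in dS, secondForm dM (inwardUnitNormal M dM) p (ν p) (ν p) * f p ^ 2
      ∂(μHE[n - 1] : Measure (E L))

/-! ### Group actions, hypersurfaces and test fields -/

section action

variable {L : ℕ} {G : Type*} [Group G]

/-- `S` is a `G`-set, for the orthogonal representation `ρ` of `G`. -/
def IsGInvariant (ρ : G →* (E L ≃ₗᵢ[ℝ] E L)) (S : Set (E L)) : Prop :=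
  ∀ g : G, ρ g '' S = S

/-- The vector field `X` on `S` satisfies `g_* X = X` for all `g ∈ G`. -/
def IsGField (ρ : G →* (E L ≃ₗᵢ[ℝ] E L)) (S : Set (E L)) (X : E L → E L) : Prop :=
  ∀ g : G, ∀ p ∈ S, X (ρ g p) = ρ g (X p)

end action

/-- `(S, dS) ⊆ (U, U ∩ ∂M)` is an almost properly embedded hypersurface of dimension `n`. The
interior of `S` may touch `dM`. -/
structure IsAlmostProperHypersurface {L : ℕ} (n : ℕ) (dM U S dS : Set (E L)) : Prop where
  submanifold : IsSubmanifoldWithBoundary n S dS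
  subset : S ⊆ U
  boundary_subset : dS ⊆ U ∩ dM

/-- The space `𝔛(M, S)`: smooth vector fields on `ℝ^L` that are tangent to `M` on `M` and tangent
to `∂M` on a neighbourhood of `∂S` in `∂M`. -/
structure IsAdmissibleField {L : ℕ} (M dM dS : Set (E L)) (X : E L → E L) : Prop where
  smooth : ContDiff ℝ ∞ X
  tangent : ∀ p ∈ M, X p ∈ tangentSp M p
  tangent_boundary : ∃ W : Set (E L), IsOpen W ∧ dS ⊆ W ∧ ∀ q ∈ W ∩ dM, X q ∈ tangentSp dM q

/-- The support in `M` of a vector field. -/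
def supportIn {L : ℕ} (M : Set (E L)) (X : E L → E L) : Set (E L) :=
  closure {p | p ∈ M ∧ X p ≠ 0}

/-- `X` is compactly supported in `U` and moves only a compact part of `S`. The second condition
follows from the first when `S` is relatively closed in `U`; it makes the integrals over `S`
meaningful in general. -/
structure HasCompactSupportIn {L : ℕ} (M U S : Set (E L)) (X : E L → E L) : Prop where
  compact : IsCompact (supportIn M X)
  subset : supportIn M X ⊆ U
  compact_inter : IsCompact (S ∩ supportIn M X)

/-! ### Stationarity and stability in `U` -/

/-- `S` is stationary in `U`. -/
def StationaryIn {L : ℕ} (n : ℕ) (M dM U S dS : Set (E L)) : Prop :=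
  ∀ X : E L → E L, IsAdmissibleField M dM dS X → HasCompactSupportIn M U S X →
    firstVariation n S X = 0

/-- `S` is stable in `U`: it is two-sided, stationary in `U`, and `δ²S(X) ≥ 0` for all
`X = f ν ∈ 𝔛(M, S)` compactly supported in `U`. -/
def StableIn {L : ℕ} (n : ℕ) (M dM U S dS : Set (E L)) : Prop :=
  StationaryIn n M dM U S dS ∧
  ∃ ν : E L → E L, IsUnitNormal M S ν ∧
    ∀ (X : E L → E L) (f : E L → ℝ), IsAdmissibleField M dM dS X → HasCompactSupportIn M U S X →
      (∀ p ∈ S, X p = f p • ν p) → 0 ≤ secondVariation n M dM S dS ν f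

/-- `S` is `G`-stationary in `U`: only `G`-invariant fields `X ∈ 𝔛^G(M, S)` are tested. -/
def GStationaryIn {L : ℕ} {G : Type*} [Group G] (ρ : G →* (E L ≃ₗᵢ[ℝ] E L)) (n : ℕ)
    (M dM U S dS : Set (E L)) : Prop :=
  ∀ X : E L → E L, IsAdmissibleField M dM dS X → IsGField ρ Set.univ X →
    HasCompactSupportIn M U S X → firstVariation n S X = 0

/-- `S` is `G`-stable in `U`: it is `G`-stationary in `U`, it has a `G`-invariant unit normal `ν`,
and `δ²S(X) ≥ 0` for all `X = f ν ∈ 𝔛^G(M, S)` compactly supported in `U`. -/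
def GStableIn {L : ℕ} {G : Type*} [Group G] (ρ : G →* (E L ≃ₗᵢ[ℝ] E L)) (n : ℕ)
    (M dM U S dS : Set (E L)) : Prop :=
  GStationaryIn ρ n M dM U S dS ∧
  ∃ ν : E L → E L, IsUnitNormal M S ν ∧ IsGField ρ S ν ∧
    ∀ (X : E L → E L) (f : E L → ℝ), IsAdmissibleField M dM dS X → IsGField ρ Set.univ X →
      HasCompactSupportIn M U S X → (∀ p ∈ S, X p = f p • ν p) →
      0 ≤ secondVariation n M dM S dS ν f

end EquivariantStability

open EquivariantStability

namespace EquivariantStability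

open Set Filter Topology

/-! ### Tangent cones -/

/-! Averaging over the Haar probability measure turns arbitrary test data into invariant data. The
first variation is linear in the field and unchanged by isometries that preserve Σ, so Y = ∫ g_*X dg
satisfies δΣ(Y) = δΣ(X), by Fubini and the isometry invariance of Hausdorff measure
(`firstVariation_avgField`). Invariant fields therefore suffice for stationarity.

The second variation is quadratic in f, and the average of f may vanish, so it is f² that is
averaged. Put r = ∫ (f ∘ g⁻¹)² dg and u_ε = √(r + ε²) - ε. By Cauchy–Schwarz |∇u_ε|² is at most the
average of |∇f|² (`norm_fderiv_regSqrt_le`). Moreover u_ε² = r - 2εu_ε, and Ric(ν,ν) + |A|² and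
h(ν,ν) are G-invariant when ν is. Hence δ²Σ(u_ε ν) ≤ δ²Σ(fν) + Cε with C independent of ε
(`setIntegral_regSqrt_le`). The left side is nonnegative by G-stability, because u_ε ν is the
restriction of the admissible invariant field (√(r + ε²) + ε)⁻¹ ∫ g_*(fX) dg. As ε tends to 0 this
gives δ²Σ(fν) ≥ 0 (`secondVariation_nonneg`); no eigenfunctions are involved. In the converse
direction the two unit normals may differ, but only by a locally constant sign, which the second
variation does not see (`secondVariation_normal_congr`).

The remaining work is to show that the geometric integrands are continuous and equivariant, although
their definitions use tangent cones, `fderivWithin`, chosen bases and a chosen inward normal.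
Everything is expressed through the orthogonal projection onto the tangent space, which has local
smooth extensions, and its iterated tangential derivatives; sums over bases become traces.
Invariance of ∂M and ∂Σ follows from that of M and Σ, since boundary points are those where the
positive tangent cone is not symmetric (`IsSubmanifoldWithBoundary.mem_boundary_iff`). -/

theorem posTangentConeAt_mapsTo {V W : Type*} [NormedAddCommGroup V] [NormedSpace ℝ V]
    [NormedAddCommGroup W] [NormedSpace ℝ W] {f : V → W} {f' : V →L[ℝ] W} {A : Set V} {B : Set W}
    {x : V} (hf : HasFDerivAt f f' x) (hAB : ∀ᶠ y in 𝓝 x, y ∈ A → f y ∈ B) :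
    MapsTo f' (posTangentConeAt A x) (posTangentConeAt B (f x)) := by
  intro y hy
  obtain ⟨ι, l, hl, c, d, hd₀, hds, hcd⟩ := exists_fun_of_mem_tangentConeAt hy
  have hxd : Tendsto (fun n => x + d n) l (𝓝 x) := by
    simpa using tendsto_const_nhds.add hd₀
  apply mem_tangentConeAt_of_seq l c (fun n ↦ f (x + d n) - f x)
  · rw [tendsto_sub_nhds_zero_iff]
    exact hf.continuousAt.tendsto.comp hxd
  · filter_upwards [hds, hxd.eventually hAB] with n hn hn'
    simpa using hn' hn
  · exact (hf.hasFDerivWithinAt (s := A)).lim (c := fun n => (c n : ℝ)) hd₀ hds hcd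

theorem tangentConeAt_mapsTo {V W : Type*} [NormedAddCommGroup V] [NormedSpace ℝ V]
    [NormedAddCommGroup W] [NormedSpace ℝ W] {f : V → W} {f' : V →L[ℝ] W} {A : Set V} {B : Set W}
    {x : V} (hf : HasFDerivAt f f' x) (hAB : ∀ᶠ y in 𝓝 x, y ∈ A → f y ∈ B) :
    MapsTo f' (tangentConeAt ℝ A x) (tangentConeAt ℝ B (f x)) := by
  intro y hy
  obtain ⟨ι, l, hl, c, d, hd₀, hds, hcd⟩ := exists_fun_of_mem_tangentConeAt hy
  have hxd : Tendsto (fun n => x + d n) l (𝓝 x) := by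
    simpa using tendsto_const_nhds.add hd₀
  apply mem_tangentConeAt_of_seq l c (fun n ↦ f (x + d n) - f x)
  · rw [tendsto_sub_nhds_zero_iff]
    exact hf.continuousAt.tendsto.comp hxd
  · filter_upwards [hds, hxd.eventually hAB] with n hn hn'
    simpa using hn' hn
  · exact (hf.hasFDerivWithinAt (s := A)).lim hd₀ hds hcd

theorem posTangentConeAt_subset_tangentConeAt {V : Type*} [NormedAddCommGroup V] [NormedSpace ℝ V]
    (A : Set V) (x : V) : posTangentConeAt A x ⊆ tangentConeAt ℝ A x := by
  intro y hy
  obtain ⟨ι, l, hl, c, d, hd₀, hds, hcd⟩ := exists_fun_of_mem_tangentConeAt hy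
  exact mem_tangentConeAt_of_seq l (fun n => (c n : ℝ)) d hd₀ hds hcd

theorem cone_subset_posTangentConeAt {V : Type*} [NormedAddCommGroup V] [NormedSpace ℝ V]
    (C : Submodule NNReal V) {x : V} (hx : x ∈ C) : (C : Set V) ⊆ posTangentConeAt C x := by
  intro y hy
  apply mem_posTangentConeAt_of_segment_subset
  rintro z ⟨a, b, ha, hb, hab, rfl⟩
  have : a • x + b • (x + y) = x + (⟨b, hb⟩ : NNReal) • y := by
    rw [smul_add, ← add_assoc, ← add_smul, hab, one_smul]; rfl
  rw [this]
  exact C.add_mem hx (C.smul_mem _ hy)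

theorem tangentConeAt_subset_submodule {V : Type*} [NormedAddCommGroup V] [NormedSpace ℝ V]
    {A : Set V} (W : Submodule ℝ V) (hW : IsClosed (W : Set V)) (hA : A ⊆ W) {x : V} (hx : x ∈ W) :
    tangentConeAt ℝ A x ⊆ W := by
  intro y hy
  obtain ⟨ι, l, hl, c, d, hd₀, hds, hcd⟩ := exists_fun_of_mem_tangentConeAt hy
  refine hW.mem_of_tendsto hcd ?_
  filter_upwards [hds] with n hn
  refine W.smul_mem _ ?_
  simpa using W.sub_mem (hA hn) hx

/-! ### Sets modelled on closed cones -/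

/-- An ambient chart of `A` that maps `A` to the closed convex cone `C`. -/
structure IsConeChart {L : ℕ} (A : Set (E L)) (e : OpenPartialHomeomorph (E L) (E L))
    (C : Submodule NNReal (E L)) : Prop where
  smooth : ContDiffOn ℝ ∞ e e.source
  smooth_symm : ContDiffOn ℝ ∞ e.symm e.target
  isClosed : IsClosed (C : Set (E L))
  mem_iff : ∀ x ∈ e.source, (x ∈ A ↔ e x ∈ C)

/-- `A` is locally diffeomorphic, by ambient charts, to closed convex cones of dimension `k`. -/
def IsSmoothPiece {L : ℕ} (k : ℕ) (A : Set (E L)) : Prop :=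
  ∀ p ∈ A, ∃ (e : OpenPartialHomeomorph (E L) (E L)) (C : Submodule NNReal (E L)), p ∈ e.source ∧
    IsConeChart A e C ∧ Module.finrank ℝ (Submodule.span ℝ (C : Set (E L))) = k

namespace IsConeChart

variable {L : ℕ} {A : Set (E L)} {e : OpenPartialHomeomorph (E L) (E L)}
  {C : Submodule NNReal (E L)} (h : IsConeChart A e C)

include h

theorem hasFDerivAt {x : E L} (hx : x ∈ e.source) : HasFDerivAt e (fderiv ℝ e x) x :=
  ((h.smooth.differentiableOn (by simp)).differentiableAt (e.open_source.mem_nhds hx)).hasFDerivAt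

theorem hasFDerivAt_symm {x : E L} (hx : x ∈ e.source) :
    HasFDerivAt e.symm (fderiv ℝ e.symm (e x)) (e x) :=
  ((h.smooth_symm.differentiableOn (by simp)).differentiableAt
    (e.open_target.mem_nhds (e.map_source hx))).hasFDerivAt

theorem fderiv_symm_apply_fderiv {x : E L} (hx : x ∈ e.source) (v : E L) :
    fderiv ℝ e.symm (e x) (fderiv ℝ e x v) = v := by
  have h1 := (h.hasFDerivAt_symm hx).comp x (h.hasFDerivAt hx)
  have h2 : HasFDerivAt (e.symm ∘ e) (ContinuousLinearMap.id ℝ (E L)) x :=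
    (hasFDerivAt_id x).congr_of_eventuallyEq (by
      filter_upwards [e.open_source.mem_nhds hx] with y hy
      exact e.left_inv hy)
  exact congrArg (fun T => T v) (h1.unique h2)

theorem fderiv_apply_fderiv_symm {x : E L} (hx : x ∈ e.source) (v : E L) :
    fderiv ℝ e x (fderiv ℝ e.symm (e x) v) = v := by
  have hx' : HasFDerivAt e (fderiv ℝ e x) (e.symm (e x)) := by
    rw [e.left_inv hx]; exact h.hasFDerivAt hx
  have h1 := hx'.comp (e x) (h.hasFDerivAt_symm hx)
  have h2 : HasFDerivAt (e ∘ e.symm) (ContinuousLinearMap.id ℝ (E L)) (e x) :=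
    (hasFDerivAt_id (e x)).congr_of_eventuallyEq (by
      filter_upwards [e.open_target.mem_nhds (e.map_source hx)] with y hy
      exact e.right_inv hy)
  exact congrArg (fun T => T v) (h1.unique h2)

theorem eventually_mem {x : E L} (hx : x ∈ e.source) : ∀ᶠ y in 𝓝 x, y ∈ A → e y ∈ (C : Set (E L)) := by
  filter_upwards [e.open_source.mem_nhds hx] with y hy using (h.mem_iff y hy).1

theorem eventually_mem_symm {x : E L} (hx : x ∈ e.source) :
    ∀ᶠ y in 𝓝 (e x), y ∈ (C : Set (E L)) → e.symm y ∈ A := by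
  filter_upwards [e.open_target.mem_nhds (e.map_source hx)] with y hy hyC
  rw [h.mem_iff _ (e.map_target hy), e.right_inv hy]
  exact hyC

theorem mem_posTangentConeAt_iff {x : E L} (hx : x ∈ e.source) (v : E L) :
    v ∈ posTangentConeAt A x ↔ fderiv ℝ e x v ∈ posTangentConeAt (C : Set (E L)) (e x) := by
  refine ⟨fun hv => posTangentConeAt_mapsTo (h.hasFDerivAt hx) (h.eventually_mem hx) hv,
    fun hv => ?_⟩
  have := posTangentConeAt_mapsTo (h.hasFDerivAt_symm hx) (h.eventually_mem_symm hx) hv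
  rwa [h.fderiv_symm_apply_fderiv hx, e.left_inv hx] at this

/-- The span of C is closed and contains C, so it contains the tangent cones of C. Conversely a
convex cone contains x + C for each of its points x, so its tangent cone at x contains C. The answer
does not depend on the point, so boundary points need no separate treatment. -/
theorem mem_tangentSp_iff {x : E L} (hx : x ∈ e.source) (hxA : x ∈ A) (v : E L) :
    v ∈ tangentSp A x ↔ fderiv ℝ e x v ∈ Submodule.span ℝ (C : Set (E L)) := by
  have hex : e x ∈ C := (h.mem_iff x hx).1 hxA
  constructor
  · intro hv
    have : tangentSp A x ≤ (Submodule.span ℝ (C : Set (E L))).comap (fderiv ℝ e x).toLinearMap := by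
      refine Submodule.span_le.2 fun w hw => ?_
      exact tangentConeAt_subset_submodule _ (Submodule.closed_of_finiteDimensional _)
        Submodule.subset_span (Submodule.subset_span hex)
        (tangentConeAt_mapsTo (h.hasFDerivAt hx) (h.eventually_mem hx) hw)
    exact this hv
  · intro hv
    have : Submodule.span ℝ (C : Set (E L)) ≤
        (tangentSp A x).comap (fderiv ℝ e.symm (e x)).toLinearMap := by
      refine Submodule.span_le.2 fun w hw => ?_
      have := posTangentConeAt_mapsTo (h.hasFDerivAt_symm hx) (h.eventually_mem_symm hx)
        (cone_subset_posTangentConeAt C hex hw)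
      rw [e.left_inv hx] at this
      exact Submodule.subset_span (posTangentConeAt_subset_tangentConeAt _ _ this)
    simpa [h.fderiv_symm_apply_fderiv hx] using this hv

theorem tangentSp_eq_map {x : E L} (hx : x ∈ e.source) (hxA : x ∈ A) :
    tangentSp A x = (Submodule.span ℝ (C : Set (E L))).map
      (fderiv ℝ e.symm (e x)).toLinearMap := by
  ext v
  rw [h.mem_tangentSp_iff hx hxA, Submodule.mem_map]
  constructor
  · exact fun hv => ⟨_, hv, h.fderiv_symm_apply_fderiv hx v⟩
  · rintro ⟨w, hw, rfl⟩
    simpa [h.fderiv_apply_fderiv_symm hx] using hw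

theorem fderiv_symm_injective {x : E L} (hx : x ∈ e.source) :
    Function.Injective (fderiv ℝ e.symm (e x)) :=
  (Function.LeftInverse.injective (h.fderiv_apply_fderiv_symm hx) :)

theorem finrank_tangentSp {x : E L} (hx : x ∈ e.source) (hxA : x ∈ A) :
    Module.finrank ℝ (tangentSp A x) = Module.finrank ℝ (Submodule.span ℝ (C : Set (E L))) := by
  rw [h.tangentSp_eq_map hx hxA]
  exact (LinearEquiv.finrank_eq (Submodule.equivMapOfInjective _ (h.fderiv_symm_injective hx) _)).symm

end IsConeChart

theorem IsSmoothPiece.finrank_tangentSp {L k : ℕ} {A : Set (E L)} (hA : IsSmoothPiece k A)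
    {p : E L} (hp : p ∈ A) : Module.finrank ℝ (tangentSp A p) = k := by
  obtain ⟨e, C, hpe, h, hk⟩ := hA p hp
  rw [h.finrank_tangentSp hpe hp, hk]

/-! ### Functions with local smooth extensions -/

/-- `F` has near each point of `A` a smooth extension to a neighbourhood in the ambient space. -/
def SmoothAlong {L : ℕ} {W : Type*} [NormedAddCommGroup W] [NormedSpace ℝ W]
    (A : Set (E L)) (F : E L → W) : Prop :=
  ∀ p ∈ A, ∃ O : Set (E L), IsOpen O ∧ p ∈ O ∧ ∃ F' : E L → W, ContDiffOn ℝ ∞ F' O ∧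
    EqOn F F' (A ∩ O)

/-! ### Smooth dependence of an orthogonal projection on a frame of its range -/

section projection

variable {V H : Type*} [NormedAddCommGroup V] [InnerProductSpace ℝ V] [NormedAddCommGroup H]
  [InnerProductSpace ℝ H] [CompleteSpace V] [CompleteSpace H]

-- Over ℝ the semilinear isometry `adjoint` is additive and continuous, hence real linear.
open ContinuousLinearMap in
theorem contDiff_adjoint : ContDiff ℝ ∞ (fun T : V →L[ℝ] H => adjoint T) := by
  let f : (V →L[ℝ] H) →+ (H →L[ℝ] V) :=
    { toFun := fun T => adjoint T, map_zero' := map_zero _, map_add' := map_add _ }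
  have hf : Continuous f := (adjoint : (V →L[ℝ] H) ≃ₗᵢ⋆[ℝ] (H →L[ℝ] V)).continuous
  exact (f.toRealLinearMap hf).contDiff

/-- The orthogonal projection onto the range of an injective operator `J` is
`J (J* J)⁻¹ J*`. -/
noncomputable def rangeProj (J : V →L[ℝ] H) : H →L[ℝ] H :=
  J ∘L (ContinuousLinearMap.inverse (J.adjoint ∘L J)) ∘L J.adjoint

variable [FiniteDimensional ℝ V]

/-- Since ⟨J*Jv, v⟩ = |Jv|², the operator J*J is injective, hence invertible in finite dimension. -/
theorem exists_equiv_adjoint_comp_self {J : V →L[ℝ] H} (hJ : Function.Injective J) :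
    ∃ f : V ≃L[ℝ] V, (f : V →L[ℝ] V) = J.adjoint ∘L J := by
  have hi : Function.Injective (J.adjoint ∘L J).toLinearMap := by
    rw [← LinearMap.ker_eq_bot, LinearMap.ker_eq_bot']
    intro v hv
    have : inner ℝ (J v) (J v) = 0 := by
      rw [← ContinuousLinearMap.adjoint_inner_left]
      have hv' : J.adjoint (J v) = 0 := hv
      rw [hv', inner_zero_left]
    exact hJ (by simpa using this)
  exact ⟨(LinearEquiv.ofInjectiveEndo _ hi).toContinuousLinearEquiv, by ext v; rfl⟩

theorem contDiffAt_rangeProj {J : V →L[ℝ] H} (hJ : Function.Injective J) :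
    ContDiffAt ℝ ∞ (rangeProj (V := V) (H := H)) J := by
  obtain ⟨f, hf⟩ := exists_equiv_adjoint_comp_self hJ
  have hadj : ContDiffAt ℝ ∞ (fun T : V →L[ℝ] H => T.adjoint) J := contDiff_adjoint.contDiffAt
  have hid : ContDiffAt ℝ ∞ (fun T : V →L[ℝ] H => T) J := contDiffAt_id
  have hinv : ContDiffAt ℝ ∞ (fun T : V →L[ℝ] H =>
      ContinuousLinearMap.inverse (T.adjoint ∘L T)) J := by
    refine ContDiffAt.comp J (g := ContinuousLinearMap.inverse) ?_ (hadj.clm_comp hid)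
    rw [← hf]
    exact contDiffAt_map_inverse f
  exact hid.clm_comp (hinv.clm_comp hadj)

theorem rangeProj_eq_starProjection {J : V →L[ℝ] H} (hJ : Function.Injective J)
    (K : Submodule ℝ H) [K.HasOrthogonalProjection] (hK : LinearMap.range J.toLinearMap = K) :
    rangeProj J = K.starProjection := by
  obtain ⟨f, hf⟩ := exists_equiv_adjoint_comp_self hJ
  ext u
  refine (Submodule.eq_starProjection_of_mem_of_inner_eq_zero ?_ ?_).symm
  · rw [← hK]; exact ⟨_, rfl⟩
  · intro w hw
    rw [← hK] at hw
    obtain ⟨v, rfl⟩ := hw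
    change inner ℝ _ (J v) = 0
    have h1 : J.adjoint (rangeProj J u) = J.adjoint u := by
      have := f.apply_symm_apply (J.adjoint u)
      rw [← ContinuousLinearEquiv.coe_coe f, hf] at this
      have h2 : rangeProj J u = J (f.symm (J.adjoint u)) := by simp [rangeProj, ← hf]
      rw [h2]
      exact this
    rw [← ContinuousLinearMap.adjoint_inner_left, map_sub, h1, sub_self, inner_zero_left]

end projection

/-- The derivative of the inverse chart frames the tangent space. The right side makes sense and is
smooth on the whole chart domain, also off A, and thus serves as a local extension of the
projection. -/
theorem IsConeChart.tangentProj_eq {L : ℕ} {A : Set (E L)}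
    {e : OpenPartialHomeomorph (E L) (E L)} {C : Submodule NNReal (E L)} (h : IsConeChart A e C)
    {x : E L} (hx : x ∈ e.source) (hxA : x ∈ A) :
    tangentProj A x = rangeProj (fderiv ℝ e.symm (e x) ∘L
      (Submodule.span ℝ (C : Set (E L))).subtypeL) := by
  refine (rangeProj_eq_starProjection ?_ _ ?_).symm
  · exact (h.fderiv_symm_injective hx).comp Subtype.val_injective
  · rw [h.tangentSp_eq_map hx hxA]
    ext v; simp

theorem IsConeChart.contDiffOn_rangeProj {L : ℕ} {A : Set (E L)}
    {e : OpenPartialHomeomorph (E L) (E L)} {C : Submodule NNReal (E L)} (h : IsConeChart A e C) :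
    ContDiffOn ℝ ∞ (fun x => rangeProj (fderiv ℝ e.symm (e x) ∘L
      (Submodule.span ℝ (C : Set (E L))).subtypeL)) e.source := by
  intro x hx
  have h1 : ContDiffOn ℝ ∞ (fun x => fderiv ℝ e.symm (e x)) e.source :=
    (h.smooth_symm.fderiv_of_isOpen e.open_target le_rfl).comp h.smooth e.mapsTo
  refine ContDiffAt.comp_contDiffWithinAt x (g := rangeProj) (contDiffAt_rangeProj ?_)
    ((h1.clm_comp contDiffOn_const) x hx)
  exact (h.fderiv_symm_injective hx).comp Subtype.val_injective

theorem IsSmoothPiece.smoothAlong_tangentProj {L k : ℕ} {A : Set (E L)}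
    (hA : IsSmoothPiece k A) : SmoothAlong A (tangentProj A) := by
  intro p hp
  obtain ⟨e, C, hpe, h, -⟩ := hA p hp
  exact ⟨e.source, e.open_source, hpe, _, h.contDiffOn_rangeProj,
    fun x hx => h.tangentProj_eq hx.2 hx.1⟩

section smoothAlong

variable {L k : ℕ} {A : Set (E L)} {W W₁ W₂ : Type*} [NormedAddCommGroup W] [NormedSpace ℝ W]
  [NormedAddCommGroup W₁] [NormedSpace ℝ W₁] [NormedAddCommGroup W₂] [NormedSpace ℝ W₂]

theorem SmoothAlong.mono {F : E L → W} (hF : SmoothAlong A F) {B : Set (E L)} (hB : B ⊆ A) :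
    SmoothAlong B F := by
  intro p hp
  obtain ⟨O, hO, hpO, F', hF', he⟩ := hF p (hB hp)
  exact ⟨O, hO, hpO, F', hF', he.mono (inter_subset_inter_left _ hB)⟩

theorem SmoothAlong.congr {F G : E L → W} (hF : SmoothAlong A F) (h : EqOn G F A) :
    SmoothAlong A G := by
  intro p hp
  obtain ⟨O, hO, hpO, F', hF', he⟩ := hF p hp
  exact ⟨O, hO, hpO, F', hF', fun x hx => (h hx.1).trans (he hx)⟩

theorem _root_.ContDiff.smoothAlong {F : E L → W} (hF : ContDiff ℝ ∞ F) (A : Set (E L)) :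
    SmoothAlong A F :=
  fun _ _ => ⟨univ, isOpen_univ, mem_univ _, F, hF.contDiffOn, fun _ _ => rfl⟩

theorem SmoothAlong.map {F : E L → W} (hF : SmoothAlong A F) {Φ : W → W₁} (hΦ : ContDiff ℝ ∞ Φ) :
    SmoothAlong A (fun p => Φ (F p)) := by
  intro p hp
  obtain ⟨O, hO, hpO, F', hF', he⟩ := hF p hp
  exact ⟨O, hO, hpO, _, hΦ.comp_contDiffOn hF', fun x hx => congrArg Φ (he hx)⟩

theorem SmoothAlong.prodMk {F : E L → W} (hF : SmoothAlong A F) {G : E L → W₁}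
    (hG : SmoothAlong A G) : SmoothAlong A (fun p => (F p, G p)) := by
  intro p hp
  obtain ⟨O, hO, hpO, F', hF', he⟩ := hF p hp
  obtain ⟨O', hO', hpO', G', hG', he'⟩ := hG p hp
  exact ⟨O ∩ O', hO.inter hO', ⟨hpO, hpO'⟩, fun x => (F' x, G' x),
    (hF'.mono inter_subset_left).prodMk (hG'.mono inter_subset_right),
    fun x hx => Prod.ext (he ⟨hx.1, hx.2.1⟩) (he' ⟨hx.1, hx.2.2⟩)⟩

theorem SmoothAlong.map₂ {F : E L → W} (hF : SmoothAlong A F) {G : E L → W₁}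
    (hG : SmoothAlong A G) {Φ : W × W₁ → W₂} (hΦ : ContDiff ℝ ∞ Φ) :
    SmoothAlong A (fun p => Φ (F p, G p)) :=
  (hF.prodMk hG).map hΦ

theorem SmoothAlong.continuousOn {F : E L → W} (hF : SmoothAlong A F) : ContinuousOn F A := by
  intro p hp
  obtain ⟨O, hO, hpO, F', hF', he⟩ := hF p hp
  have h1 : ContinuousWithinAt F' A p :=
    (hF'.continuousOn.continuousAt (hO.mem_nhds hpO)).continuousWithinAt
  refine h1.congr_of_eventuallyEq ?_ (he ⟨hp, hpO⟩)
  filter_upwards [self_mem_nhdsWithin, mem_nhdsWithin_of_mem_nhds (hO.mem_nhds hpO)] with x h h'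
  exact he ⟨h, h'⟩

theorem SmoothAlong.clm_apply {F : E L → W →L[ℝ] W₁} (hF : SmoothAlong A F) {G : E L → W}
    (hG : SmoothAlong A G) : SmoothAlong A (fun p => F p (G p)) :=
  hF.map₂ hG (Φ := fun x => x.1 x.2) (contDiff_fst.clm_apply contDiff_snd)

theorem SmoothAlong.clm_comp {F : E L → W₁ →L[ℝ] W₂} (hF : SmoothAlong A F) {G : E L → W →L[ℝ] W₁}
    (hG : SmoothAlong A G) : SmoothAlong A (fun p => F p ∘L G p) :=
  hF.map₂ hG (Φ := fun x => x.1 ∘L x.2) (contDiff_fst.clm_comp contDiff_snd)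

/-! ### Tangential derivatives -/

theorem tangentProj_mem (A : Set (E L)) (p v : E L) : tangentProj A p v ∈ tangentSp A p :=
  Submodule.starProjection_apply_mem _ _

theorem tangentProj_of_mem {p v : E L} (hv : v ∈ tangentSp A p) : tangentProj A p v = v :=
  Submodule.starProjection_eq_self_iff.2 hv

theorem tangentProj_tangentProj (A : Set (E L)) (p v : E L) :
    tangentProj A p (tangentProj A p v) = tangentProj A p v :=
  tangentProj_of_mem (tangentProj_mem A p v)

theorem tangentialDeriv_tangentProj (A : Set (E L)) (F : E L → W) (p v : E L) :
    tangentialDeriv A F p (tangentProj A p v) = tangentialDeriv A F p v := by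
  simp [tangentialDeriv, tangentProj_tangentProj]

/-- A derivative within A need not be unique in normal directions, but it is determined on the
tangent cone and hence on its span. This is what makes `tangentialDeriv` independent of the choice
hidden in `fderivWithin`. -/
theorem eqOn_tangentSp {F : E L → W} {T T' : E L →L[ℝ] W} {p : E L}
    (h : HasFDerivWithinAt F T A p) (h' : HasFDerivWithinAt F T' A p) {v : E L}
    (hv : v ∈ tangentSp A p) : T v = T' v := by
  have := LinearMap.eqOn_span (f := T.toLinearMap) (g := T'.toLinearMap)
    (s := tangentConeAt ℝ A p) (fun x hx => h.unique_on h' hx)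
  exact this hv

theorem tangentialDeriv_eq_of_hasFDerivWithinAt {F : E L → W} {T : E L →L[ℝ] W} {p : E L}
    (h : HasFDerivWithinAt F T A p) : tangentialDeriv A F p = T ∘L tangentProj A p := by
  ext v
  exact eqOn_tangentSp h.differentiableWithinAt.hasFDerivWithinAt h (tangentProj_mem A p v)

theorem tangentialDeriv_eq {F F' : E L → W} {p : E L} {O : Set (E L)} (hF' : DifferentiableAt ℝ F' p)
    (hO : O ∈ 𝓝 p) (hp : p ∈ A) (he : EqOn F F' (A ∩ O)) :
    tangentialDeriv A F p = fderiv ℝ F' p ∘L tangentProj A p := by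
  apply tangentialDeriv_eq_of_hasFDerivWithinAt
  refine (hF'.hasFDerivAt.hasFDerivWithinAt).congr_of_eventuallyEq ?_
    (he ⟨hp, mem_of_mem_nhds hO⟩)
  filter_upwards [self_mem_nhdsWithin, mem_nhdsWithin_of_mem_nhds hO] with x h h' using he ⟨h, h'⟩

theorem tangentialDeriv_congr {F G : E L → W} {p : E L} (hp : p ∈ A) (h : EqOn F G A) :
    tangentialDeriv A F p = tangentialDeriv A G p := by
  rw [tangentialDeriv, tangentialDeriv, fderivWithin_congr h (h hp)]

theorem tangentialDeriv_congr_nhds {F G : E L → W} {p : E L} (hp : p ∈ A) (h : F =ᶠ[𝓝[A] p] G) :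
    tangentialDeriv A F p = tangentialDeriv A G p := by
  rw [tangentialDeriv, tangentialDeriv, h.fderivWithin_eq (h.self_of_nhdsWithin hp)]

theorem SmoothAlong.hasFDerivWithinAt {F : E L → W} (hF : SmoothAlong A F) {p : E L} (hp : p ∈ A) :
    HasFDerivWithinAt F (fderivWithin ℝ F A p) A p := by
  obtain ⟨O, hO, hpO, F', hF', he⟩ := hF p hp
  apply DifferentiableWithinAt.hasFDerivWithinAt
  have h1 : DifferentiableAt ℝ F' p :=
    (hF'.differentiableOn (by simp)).differentiableAt (hO.mem_nhds hpO)
  refine h1.differentiableWithinAt.congr_of_eventuallyEq ?_ (he ⟨hp, hpO⟩)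
  filter_upwards [self_mem_nhdsWithin, mem_nhdsWithin_of_mem_nhds (hO.mem_nhds hpO)] with x h h'
    using he ⟨h, h'⟩

/-- On A the tangential derivative is the derivative of a local extension composed with the
projection, and both factors extend smoothly. Tangential derivatives can therefore be iterated. -/
theorem SmoothAlong.tangentialDeriv {F : E L → W} (hF : SmoothAlong A F)
    (hA : IsSmoothPiece k A) : SmoothAlong A (tangentialDeriv A F) := by
  have h1 : ∀ p ∈ A, ∃ O : Set (E L), IsOpen O ∧ p ∈ O ∧ ∃ G : E L → E L →L[ℝ] W,
      ContDiffOn ℝ ∞ G O ∧ EqOn (EquivariantStability.tangentialDeriv A F)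
        (fun x => G x ∘L tangentProj A x) (A ∩ O) := by
    intro p hp
    obtain ⟨O, hO, hpO, F', hF', he⟩ := hF p hp
    refine ⟨O, hO, hpO, fderiv ℝ F', hF'.fderiv_of_isOpen hO le_rfl, fun x hx => ?_⟩
    exact tangentialDeriv_eq ((hF'.differentiableOn (by simp)).differentiableAt
      (hO.mem_nhds hx.2)) (hO.mem_nhds hx.2) hx.1 he
  intro p hp
  obtain ⟨O, hO, hpO, G, hG, he⟩ := h1 p hp
  obtain ⟨O', hO', hpO', P, hP, he'⟩ := hA.smoothAlong_tangentProj p hp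
  refine ⟨O ∩ O', hO.inter hO', ⟨hpO, hpO'⟩, fun x => G x ∘L P x,
    (hG.mono inter_subset_left).clm_comp (hP.mono inter_subset_right), fun x hx => ?_⟩
  rw [he ⟨hx.1, hx.2.1⟩]
  exact congrArg (G x ∘L ·) (he' ⟨hx.1, hx.2.2⟩)

theorem SmoothAlong.tangentialDeriv_clm {F : E L → W} (hF : SmoothAlong A F) (T : W →L[ℝ] W₁)
    {p : E L} (hp : p ∈ A) : EquivariantStability.tangentialDeriv A (fun q => T (F q)) p =
      T ∘L EquivariantStability.tangentialDeriv A F p :=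
  tangentialDeriv_eq_of_hasFDerivWithinAt
    (T.hasFDerivAt.comp_hasFDerivWithinAt p (hF.hasFDerivWithinAt hp))

/-! ### Naturality under isometries -/

variable {φ : E L ≃ₗᵢ[ℝ] E L}

theorem apply_mem_of_image_eq (hA : φ '' A = A) {p : E L} (hp : p ∈ A) : φ p ∈ A :=
  hA ▸ mem_image_of_mem φ hp

theorem image_symm_eq (hA : φ '' A = A) : φ.symm '' A = A := by
  conv_lhs => rw [← hA]
  rw [image_image]; simp

theorem apply_mem_iff (hA : φ '' A = A) {p : E L} : φ p ∈ A ↔ p ∈ A := by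
  refine ⟨fun h => ?_, apply_mem_of_image_eq hA⟩
  simpa using apply_mem_of_image_eq (image_symm_eq hA) h

theorem apply_mem_posTangentConeAt (hA : φ '' A = A) {p v : E L} (hv : v ∈ posTangentConeAt A p) :
    φ v ∈ posTangentConeAt A (φ p) :=
  posTangentConeAt_mapsTo (f := φ) (φ.toContinuousLinearEquiv : E L →L[ℝ] E L).hasFDerivAt
    (Eventually.of_forall fun _ hy => apply_mem_of_image_eq hA hy) hv

theorem apply_mem_tangentSp (hA : φ '' A = A) {p v : E L} (hv : v ∈ tangentSp A p) :
    φ v ∈ tangentSp A (φ p) := by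
  have : tangentSp A p ≤ (tangentSp A (φ p)).comap φ.toLinearEquiv.toLinearMap := by
    refine Submodule.span_le.2 fun w hw => Submodule.subset_span ?_
    exact tangentConeAt_mapsTo (f := φ) (φ.toContinuousLinearEquiv : E L →L[ℝ] E L).hasFDerivAt
      (Eventually.of_forall fun _ hy => apply_mem_of_image_eq hA hy) hw
  exact this hv

theorem apply_mem_tangentSp_iff (hA : φ '' A = A) {p v : E L} :
    φ v ∈ tangentSp A (φ p) ↔ v ∈ tangentSp A p := by
  refine ⟨fun h => ?_, apply_mem_tangentSp hA⟩
  simpa using apply_mem_tangentSp (image_symm_eq hA) h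

theorem tangentProj_apply (hA : φ '' A = A) (p v : E L) :
    tangentProj A (φ p) (φ v) = φ (tangentProj A p v) := by
  refine Submodule.eq_starProjection_of_mem_of_inner_eq_zero
    (apply_mem_tangentSp hA (tangentProj_mem A p v)) fun w hw => ?_
  obtain ⟨w, rfl⟩ := φ.surjective w
  rw [← map_sub, LinearIsometryEquiv.inner_map_map]
  exact Submodule.starProjection_inner_eq_zero _ _ ((apply_mem_tangentSp_iff hA).1 hw)

/-- A linear isometry equivalence as a continuous linear map. -/
noncomputable abbrev isomCLM (φ : E L ≃ₗᵢ[ℝ] E L) : E L →L[ℝ] E L :=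
  (φ.toContinuousLinearEquiv : E L →L[ℝ] E L)

/-- The map `T ↦ S ∘ T ∘ φ⁻¹`. -/
noncomputable def conjCLM (φ : E L ≃ₗᵢ[ℝ] E L) (S : W →L[ℝ] W) : (E L →L[ℝ] W) →L[ℝ] (E L →L[ℝ] W) :=
  (ContinuousLinearMap.compL ℝ (E L) W W S) ∘L
    ((ContinuousLinearMap.compL ℝ (E L) (E L) W).flip (isomCLM φ.symm))

@[simp]
theorem conjCLM_apply (φ : E L ≃ₗᵢ[ℝ] E L) (S : W →L[ℝ] W) (T : E L →L[ℝ] W) (v : E L) :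
    conjCLM φ S T v = S (T (φ.symm v)) := rfl

theorem tangentProj_conj (hA : φ '' A = A) (p : E L) :
    tangentProj A (φ p) = conjCLM φ (isomCLM φ) (tangentProj A p) := by
  ext1 v
  obtain ⟨v, rfl⟩ := φ.surjective v
  rw [tangentProj_apply hA]; simp

/-- Differentiate F ∘ φ = S ∘ F within A in both ways and compare on tangent vectors. A general S
lets the lemma be iterated: the derivative is again equivariant, now for `conjCLM φ S`. -/
theorem SmoothAlong.tangentialDeriv_conj {F : E L → W} (hF : SmoothAlong A F) (hA : φ '' A = A)
    (S : W →L[ℝ] W) (hS : ∀ q ∈ A, F (φ q) = S (F q)) {p : E L} (hp : p ∈ A) :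
    EquivariantStability.tangentialDeriv A F (φ p) =
      conjCLM φ S (EquivariantStability.tangentialDeriv A F p) := by
  have h1 : HasFDerivWithinAt (fun q => F (φ q)) (fderivWithin ℝ F A (φ p) ∘L isomCLM φ) A p :=
    (hF.hasFDerivWithinAt (apply_mem_of_image_eq hA hp)).comp p
      (isomCLM φ).hasFDerivAt.hasFDerivWithinAt fun q hq => apply_mem_of_image_eq hA hq
  have h2 : HasFDerivWithinAt (fun q => F (φ q)) (S ∘L fderivWithin ℝ F A p) A p :=
    (S.hasFDerivAt.comp_hasFDerivWithinAt p (hF.hasFDerivWithinAt hp)).congr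
      (fun q hq => hS q hq) (hS p hp)
  ext1 v
  obtain ⟨v, rfl⟩ := φ.surjective v
  have := eqOn_tangentSp h1 h2 (tangentProj_mem A p v)
  rw [conjCLM_apply, φ.symm_apply_apply]
  simp only [EquivariantStability.tangentialDeriv, ContinuousLinearMap.comp_apply,
    tangentProj_apply hA]
  exact this

end smoothAlong

set_option maxSynthPendingDepth 3

section curvature

variable {L k : ℕ} {M : Set (E L)}

/-! ### The curvature tensor in terms of the derivatives of the tangent projection -/

/-- The tangential derivative of the tangent projection of `M`. -/
noncomputable def projDeriv (M : Set (E L)) : E L → E L →L[ℝ] E L →L[ℝ] E L :=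
  tangentialDeriv M (tangentProj M)

/-- The bilinear map `(y, z) ↦ ∇_y Z` for `Z` the tangent extension of `z`. -/
noncomputable def connectionTensor (M : Set (E L)) (p : E L) : E L →L[ℝ] E L →L[ℝ] E L :=
  (ContinuousLinearMap.compL ℝ (E L) (E L) (E L) (tangentProj M p)) ∘L projDeriv M p

/-- The tangential derivative of the connection tensor. -/
noncomputable def connectionDeriv (M : Set (E L)) : E L → E L →L[ℝ] E L →L[ℝ] E L →L[ℝ] E L :=
  tangentialDeriv M (connectionTensor M)

theorem IsSmoothPiece.smoothAlong_projDeriv (hM : IsSmoothPiece k M) :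
    SmoothAlong M (projDeriv M) :=
  hM.smoothAlong_tangentProj.tangentialDeriv hM

theorem IsSmoothPiece.smoothAlong_connectionTensor (hM : IsSmoothPiece k M) :
    SmoothAlong M (connectionTensor M) :=
  (hM.smoothAlong_tangentProj.map (ContinuousLinearMap.contDiff _)).clm_comp
    hM.smoothAlong_projDeriv

theorem IsSmoothPiece.smoothAlong_connectionDeriv (hM : IsSmoothPiece k M) :
    SmoothAlong M (connectionDeriv M) :=
  hM.smoothAlong_connectionTensor.tangentialDeriv hM

/-- Evaluation at a vector. -/
noncomputable abbrev evalCLM {W : Type*} [NormedAddCommGroup W] [NormedSpace ℝ W] (z : E L) :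
    (E L →L[ℝ] W) →L[ℝ] W := ContinuousLinearMap.apply ℝ W z

theorem IsSmoothPiece.tangentialDeriv_tangentExtension (hM : IsSmoothPiece k M) {p : E L}
    (hp : p ∈ M) (y z : E L) :
    tangentialDeriv M (tangentExtension M z) p y = projDeriv M p y z := by
  have := hM.smoothAlong_tangentProj.tangentialDeriv_clm (evalCLM z) hp
  exact congrArg (fun T => T y) this

theorem IsSmoothPiece.covDeriv_tangentExtension (hM : IsSmoothPiece k M) {p : E L}
    (hp : p ∈ M) (Y : E L → E L) (z : E L) :
    covDeriv M Y (tangentExtension M z) p = connectionTensor M p (Y p) z := by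
  rw [covDeriv, hM.tangentialDeriv_tangentExtension hp]; rfl

/-- Allows the moving argument q ↦ P_q y to be replaced by the constant y before the next
differentiation, so that only the tensor itself is differentiated. -/
theorem connectionTensor_tangentProj (p y z : E L) :
    connectionTensor M p (tangentProj M p y) z = connectionTensor M p y z := by
  have : projDeriv M p (tangentProj M p y) = projDeriv M p y := tangentialDeriv_tangentProj _ _ _ _
  simp only [connectionTensor, ContinuousLinearMap.comp_apply, this]

theorem IsSmoothPiece.covDeriv_covDeriv (hM : IsSmoothPiece k M) {p : E L} (hp : p ∈ M)
    (x y z : E L) :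
    covDeriv M (tangentExtension M x)
      (covDeriv M (tangentExtension M y) (tangentExtension M z)) p =
    tangentProj M p (connectionDeriv M p x y z) := by
  have h1 : EqOn (covDeriv M (tangentExtension M y) (tangentExtension M z))
      (fun q => (evalCLM z ∘L evalCLM y) (connectionTensor M q)) M := fun q hq => by
    rw [hM.covDeriv_tangentExtension hq, tangentExtension, connectionTensor_tangentProj]; rfl
  rw [covDeriv, tangentialDeriv_congr hp h1,
    hM.smoothAlong_connectionTensor.tangentialDeriv_clm _ hp, tangentExtension]
  have : connectionDeriv M p (tangentProj M p x) = connectionDeriv M p x :=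
    tangentialDeriv_tangentProj _ _ _ _
  change tangentProj M p (connectionDeriv M p (tangentProj M p x) y z) = _
  rw [this]

/-- The operator `x ↦ R(x, y)z`, expressed by the connection tensor and its derivative. -/
noncomputable def curvatureOp (M : Set (E L)) (p y z : E L) : E L →L[ℝ] E L :=
  tangentProj M p ∘L ((connectionDeriv M p).flip y).flip z
    - tangentProj M p ∘L (connectionDeriv M p y).flip z
    - (connectionTensor M p).flip z ∘L ((projDeriv M p).flip y - projDeriv M p y)

/-- Exhibits the curvature as a linear operator in x on the whole ambient space, so that Ricci
curvature is a trace and inherits continuity and naturality from the projection. -/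
theorem IsSmoothPiece.riemann_eq (hM : IsSmoothPiece k M) {p : E L} (hp : p ∈ M) (x y z : E L) :
    riemann M p x y z = curvatureOp M p y z x := by
  have hb : bracket M (tangentExtension M x) (tangentExtension M y) p =
      projDeriv M p x y - projDeriv M p y x := by
    have (v w : E L) : projDeriv M p (tangentProj M p v) w = projDeriv M p v w :=
      congrArg (fun T : E L →L[ℝ] E L => T w) (tangentialDeriv_tangentProj _ _ _ _)
    simp only [bracket, hM.tangentialDeriv_tangentExtension hp]
    rw [tangentExtension, tangentExtension, this, this]
  simp only [riemann, hM.covDeriv_covDeriv hp, hM.covDeriv_tangentExtension hp, hb]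
  simp [curvatureOp]

/-! ### Traces -/

/-- The trace of an endomorphism. -/
noncomputable def clmTrace (L : ℕ) : (E L →L[ℝ] E L) →L[ℝ] ℝ :=
  LinearMap.toContinuousLinearMap (LinearMap.trace ℝ (E L) ∘ₗ ContinuousLinearMap.coeLM ℝ)

theorem clmTrace_conj (φ : E L ≃ₗᵢ[ℝ] E L) (T : E L →L[ℝ] E L) :
    clmTrace L (conjCLM φ (isomCLM φ) T) = clmTrace L T :=
  LinearMap.trace_conj' (T : E L →ₗ[ℝ] E L) φ.toLinearEquiv

/-- `stdOrthonormalBasis` is an arbitrary choice, with no relation between its values at p and at φ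
p; the trace removes it. -/
theorem sum_inner_stdOrthonormalBasis (K : Submodule ℝ (E L)) (T : E L →L[ℝ] E L) :
    ∑ i, inner ℝ (T (stdOrthonormalBasis ℝ K i)) (stdOrthonormalBasis ℝ K i : E L) =
      clmTrace L (T ∘L K.starProjection) := by
  have h1 : clmTrace L (T ∘L K.starProjection) =
      LinearMap.trace ℝ (E L) ((T.toLinearMap ∘ₗ K.subtype) ∘ₗ
        K.orthogonalProjectionOnto.toLinearMap) := rfl
  rw [h1, LinearMap.trace_comp_comm', LinearMap.trace_eq_sum_inner _ (stdOrthonormalBasis ℝ K)]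
  refine Finset.sum_congr rfl fun i _ => ?_
  rw [real_inner_comm]
  simp

theorem surfaceDiv_eq_clmTrace (S : Set (E L)) (X : E L → E L) (p : E L) :
    surfaceDiv S X p = clmTrace L (fderiv ℝ X p ∘L tangentProj S p) :=
  sum_inner_stdOrthonormalBasis _ _

theorem IsSmoothPiece.ricci_eq_clmTrace (hM : IsSmoothPiece k M) {p : E L} (hp : p ∈ M)
    (v w : E L) : ricci M p v w = clmTrace L (curvatureOp M p v w ∘L tangentProj M p) := by
  simp only [ricci, hM.riemann_eq hp]
  exact sum_inner_stdOrthonormalBasis _ _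

/-- With D the tangential derivative of ν and P the projection onto the tangent space, the sum over
j is |P D e_i|², and summing over i gives tr(D* P D P). -/
theorem secondFormNormSq_eq_clmTrace (S : Set (E L)) (ν : E L → E L) (p : E L) :
    secondFormNormSq S ν p = clmTrace L (((tangentialDeriv S ν p).adjoint ∘L tangentProj S p ∘L
      tangentialDeriv S ν p) ∘L tangentProj S p) := by
  rw [tangentProj, ← sum_inner_stdOrthonormalBasis]
  refine Finset.sum_congr rfl fun i _ => ?_
  set w := tangentialDeriv S ν p (stdOrthonormalBasis ℝ (tangentSp S p) i)
  have h1 : inner ℝ ((((tangentialDeriv S ν p).adjoint ∘L (tangentSp S p).starProjection ∘L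
      tangentialDeriv S ν p)) (stdOrthonormalBasis ℝ (tangentSp S p) i))
      (stdOrthonormalBasis ℝ (tangentSp S p) i : E L) =
      inner ℝ ((tangentSp S p).starProjection w) w := by
    simp only [ContinuousLinearMap.comp_apply, ContinuousLinearMap.adjoint_inner_left]; rfl
  have h2 : inner ℝ ((tangentSp S p).starProjection w) w =
      ‖(tangentSp S p).orthogonalProjectionOnto w‖ ^ 2 := by
    rw [← real_inner_self_eq_norm_sq, Submodule.coe_inner]
    have := Submodule.starProjection_inner_eq_zero (K := tangentSp S p) w _
      (Submodule.starProjection_apply_mem (tangentSp S p) w)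
    rw [inner_sub_left, sub_eq_zero, real_inner_comm] at this
    exact this
  rw [h1, h2, ← (stdOrthonormalBasis ℝ (tangentSp S p)).sum_sq_inner_left]
  refine Finset.sum_congr rfl fun j _ => ?_
  simp [secondForm, w]

/-! ### Continuity -/

theorem IsSmoothPiece.continuousOn_ricci (hM : IsSmoothPiece k M) {S : Set (E L)} (hS : S ⊆ M)
    {ν : E L → E L} (hν : ContinuousOn ν S) : ContinuousOn (fun p => ricci M p (ν p) (ν p)) S := by
  have hP := hM.smoothAlong_tangentProj.continuousOn.mono hS
  have hB := hM.smoothAlong_projDeriv.continuousOn.mono hS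
  have hΓ := hM.smoothAlong_connectionTensor.continuousOn.mono hS
  have hC := hM.smoothAlong_connectionDeriv.continuousOn.mono hS
  have hflip {F : E L → E L →L[ℝ] E L →L[ℝ] E L} (hF : ContinuousOn F S) :
      ContinuousOn (fun p => (F p).flip) S :=
    (ContinuousLinearMap.flipₗᵢ ℝ (E L) (E L) (E L)).continuous.comp_continuousOn hF
  have hflip' : ContinuousOn (fun p => (connectionDeriv M p).flip) S :=
    (ContinuousLinearMap.flipₗᵢ ℝ (E L) (E L) (E L →L[ℝ] E L)).continuous.comp_continuousOn hC
  have h1 : ContinuousOn (fun p => curvatureOp M p (ν p) (ν p)) S := by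
    refine ((hP.clm_comp ((hflip (hflip'.clm_apply hν)).clm_apply hν)).sub
      (hP.clm_comp ((hflip (hC.clm_apply hν)).clm_apply hν))).sub
      (((hflip hΓ).clm_apply hν).clm_comp (((hflip hB).clm_apply hν).sub (hB.clm_apply hν)))
  exact ((clmTrace L).continuous.comp_continuousOn (h1.clm_comp hP)).congr
    fun p hp => hM.ricci_eq_clmTrace (hS hp) _ _

theorem IsSmoothPiece.continuousOn_secondFormNormSq {S : Set (E L)} (hS : IsSmoothPiece k S)
    {ν : E L → E L} (hν : SmoothAlong S ν) : ContinuousOn (secondFormNormSq S ν) S := by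
  have hP := hS.smoothAlong_tangentProj.continuousOn
  have hD := (hν.tangentialDeriv hS).continuousOn
  have hA : ContinuousOn (fun p => (tangentialDeriv S ν p).adjoint) S :=
    contDiff_adjoint.continuous.comp_continuousOn hD
  exact ((clmTrace L).continuous.comp_continuousOn
    ((hA.clm_comp (hP.clm_comp hD)).clm_comp hP)).congr
    fun p _ => secondFormNormSq_eq_clmTrace S ν p

theorem IsSmoothPiece.continuousOn_secondForm {S B : Set (E L)} (hB : IsSmoothPiece k B)
    {N ν : E L → E L} (hN : SmoothAlong B N) (hSB : S ⊆ B) (hν : ContinuousOn ν S) :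
    ContinuousOn (fun p => secondForm B N p (ν p) (ν p)) S :=
  ((((hN.tangentialDeriv hB).continuousOn.mono hSB).clm_apply hν).inner hν).neg

/-! ### Naturality -/

variable {φ : E L ≃ₗᵢ[ℝ] E L}

theorem IsSmoothPiece.projDeriv_conj (hM : IsSmoothPiece k M) (hφ : φ '' M = M) {p : E L}
    (hp : p ∈ M) :
    projDeriv M (φ p) = conjCLM φ (conjCLM φ (isomCLM φ)) (projDeriv M p) :=
  hM.smoothAlong_tangentProj.tangentialDeriv_conj hφ _ (fun q _ => tangentProj_conj hφ q) hp

theorem IsSmoothPiece.connectionTensor_conj (hM : IsSmoothPiece k M) (hφ : φ '' M = M) {p : E L}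
    (hp : p ∈ M) :
    connectionTensor M (φ p) = conjCLM φ (conjCLM φ (isomCLM φ)) (connectionTensor M p) := by
  ext1 y; ext1 z
  simp [connectionTensor, hM.projDeriv_conj hφ hp, tangentProj_conj hφ]

theorem IsSmoothPiece.connectionDeriv_conj (hM : IsSmoothPiece k M) (hφ : φ '' M = M) {p : E L}
    (hp : p ∈ M) : connectionDeriv M (φ p) =
      conjCLM φ (conjCLM φ (conjCLM φ (isomCLM φ))) (connectionDeriv M p) :=
  hM.smoothAlong_connectionTensor.tangentialDeriv_conj hφ _
    (fun _ hq => hM.connectionTensor_conj hφ hq) hp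

theorem IsSmoothPiece.curvatureOp_conj (hM : IsSmoothPiece k M) (hφ : φ '' M = M) {p : E L}
    (hp : p ∈ M) (y z : E L) :
    curvatureOp M (φ p) (φ y) (φ z) = conjCLM φ (isomCLM φ) (curvatureOp M p y z) := by
  ext1 x
  simp [curvatureOp, hM.projDeriv_conj hφ hp, hM.connectionTensor_conj hφ hp,
    hM.connectionDeriv_conj hφ hp, tangentProj_conj hφ]

theorem conjCLM_comp (S T : E L →L[ℝ] E L) :
    conjCLM φ (isomCLM φ) S ∘L conjCLM φ (isomCLM φ) T = conjCLM φ (isomCLM φ) (S ∘L T) := by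
  ext1 v; simp

theorem IsSmoothPiece.ricci_conj (hM : IsSmoothPiece k M) (hφ : φ '' M = M) {p : E L}
    (hp : p ∈ M) (y z : E L) : ricci M (φ p) (φ y) (φ z) = ricci M p y z := by
  rw [hM.ricci_eq_clmTrace hp, hM.ricci_eq_clmTrace (apply_mem_of_image_eq hφ hp),
    hM.curvatureOp_conj hφ hp, tangentProj_conj hφ, conjCLM_comp, clmTrace_conj]

theorem IsSmoothPiece.ricci_neg (hM : IsSmoothPiece k M) {p : E L}
    (hp : p ∈ M) (y : E L) : ricci M p (-y) (-y) = ricci M p y y := by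
  rw [hM.ricci_eq_clmTrace hp, hM.ricci_eq_clmTrace hp]
  congr 2
  ext1 x
  simp [curvatureOp, sub_eq_add_neg]

theorem adjoint_conjCLM (T : E L →L[ℝ] E L) :
    (conjCLM φ (isomCLM φ) T).adjoint = conjCLM φ (isomCLM φ) T.adjoint := by
  refine (ContinuousLinearMap.eq_adjoint_iff _ _).2 (fun x y => ?_) |>.symm
  obtain ⟨x, rfl⟩ := φ.surjective x
  obtain ⟨y, rfl⟩ := φ.surjective y
  simp [ContinuousLinearMap.adjoint_inner_left]

theorem secondFormNormSq_conj {S : Set (E L)} {ν : E L → E L} (hν : SmoothAlong S ν)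
    (hφ : φ '' S = S) (hφν : ∀ q ∈ S, ν (φ q) = φ (ν q)) {p : E L} (hp : p ∈ S) :
    secondFormNormSq S ν (φ p) = secondFormNormSq S ν p := by
  rw [secondFormNormSq_eq_clmTrace, secondFormNormSq_eq_clmTrace,
    hν.tangentialDeriv_conj hφ (isomCLM φ) hφν hp, tangentProj_conj hφ, adjoint_conjCLM,
    conjCLM_comp, conjCLM_comp, conjCLM_comp, clmTrace_conj]

theorem secondForm_conj {B : Set (E L)} {N : E L → E L} (hN : SmoothAlong B N)
    (hφ : φ '' B = B) (hφN : ∀ q ∈ B, N (φ q) = φ (N q)) {p : E L} (hp : p ∈ B) (v w : E L) :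
    secondForm B N (φ p) (φ v) (φ w) = secondForm B N p v w := by
  rw [secondForm, secondForm, hN.tangentialDeriv_conj hφ (isomCLM φ) hφN hp]
  simp

end curvature

/-! ### The model cones -/

section models

variable {L k : ℕ}

/-- The coordinate subspace spanned by the basis vectors with index in `I`. -/
def coordSubspace (L : ℕ) (I : Set (Fin L)) : Submodule ℝ (E L) where
  carrier := {y | ∀ i ∉ I, y i = 0}
  add_mem' := fun ha hb i hi => by simp [ha i hi, hb i hi]
  zero_mem' := fun i _ => by simp
  smul_mem' := fun c x hx i hi => by simp [hx i hi]

theorem finrank_coordSubspace (I : Set (Fin L)) :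
    Module.finrank ℝ (coordSubspace L I) = Nat.card I := by
  classical
  let f : coordSubspace L I ≃ₗ[ℝ] (I → ℝ) :=
    { toFun := fun y i => (y : E L) i
      map_add' := fun _ _ => rfl
      map_smul' := fun _ _ => rfl
      invFun := fun g => ⟨WithLp.toLp 2 fun i => if h : i ∈ I then g ⟨i, h⟩ else 0,
        fun i hi => by simp [hi]⟩
      left_inv := fun y => by
        ext i
        by_cases hi : i ∈ I
        · simp [hi]
        · simp [hi, y.2 i hi]
      right_inv := fun g => by ext i; simp }
  rw [f.finrank_eq, Module.finrank_fintype_fun_eq_card, Nat.card_eq_fintype_card]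

/-- `slice L k` as a closed cone. -/
def sliceCone (L k : ℕ) : Submodule NNReal (E L) where
  carrier := slice L k
  add_mem' := fun ha hb i hi => by simp [ha i hi, hb i hi]
  zero_mem' := fun i _ => by simp
  smul_mem' := fun c x hx i hi => by simp [NNReal.smul_def, hx i hi]

/-- `halfSlice L k` as a closed cone. -/
def halfSliceCone (L k : ℕ) : Submodule NNReal (E L) where
  carrier := halfSlice L k
  add_mem' := fun {a b} ha hb => ⟨(sliceCone L k).add_mem ha.1 hb.1, fun i hi => by
    simpa using add_nonneg (ha.2 i hi) (hb.2 i hi)⟩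
  zero_mem' := ⟨(sliceCone L k).zero_mem, fun i _ => by simp⟩
  smul_mem' := fun c x hx => ⟨(sliceCone L k).smul_mem c hx.1, fun i hi => by
    simpa [NNReal.smul_def] using mul_nonneg c.2 (hx.2 i hi)⟩

/-- `sliceEdge L k` as a closed cone. -/
def sliceEdgeCone (L k : ℕ) : Submodule NNReal (E L) where
  carrier := sliceEdge L k
  add_mem' := fun {a b} ha hb => ⟨(sliceCone L k).add_mem ha.1 hb.1, fun i hi => by
    simp [ha.2 i hi, hb.2 i hi]⟩
  zero_mem' := ⟨(sliceCone L k).zero_mem, fun i _ => by simp⟩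
  smul_mem' := fun c x hx => ⟨(sliceCone L k).smul_mem c hx.1, fun i hi => by
    simp [NNReal.smul_def, hx.2 i hi]⟩

theorem continuous_coord (i : Fin L) : Continuous fun y : E L => y i := by fun_prop

theorem isClosed_slice (L k : ℕ) : IsClosed (slice L k) := by
  simp only [slice, ofPred_forall]
  exact isClosed_iInter fun i => isClosed_iInter fun _ =>
    isClosed_eq (continuous_coord i) continuous_const

theorem isClosed_halfSlice (L k : ℕ) : IsClosed (halfSlice L k) := by
  refine (isClosed_slice L k).inter ?_
  change IsClosed {y : E L | ∀ i : Fin L, (i : ℕ) = 0 → 0 ≤ y i}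
  simp only [ofPred_forall]
  exact isClosed_iInter fun i => isClosed_iInter fun _ =>
    isClosed_le continuous_const (continuous_coord i)

theorem isClosed_sliceEdge (L k : ℕ) : IsClosed (sliceEdge L k) := by
  refine (isClosed_slice L k).inter ?_
  change IsClosed {y : E L | ∀ i : Fin L, (i : ℕ) = 0 → y i = 0}
  simp only [ofPred_forall]
  exact isClosed_iInter fun i => isClosed_iInter fun _ =>
    isClosed_eq (continuous_coord i) continuous_const

theorem slice_eq_coordSubspace : slice L k = coordSubspace L {i | (i : ℕ) < k} := by
  ext y; simp [slice, coordSubspace]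

theorem sliceEdge_eq_coordSubspace :
    sliceEdge L k = coordSubspace L {i | (i : ℕ) < k ∧ (i : ℕ) ≠ 0} := by
  ext y
  simp only [sliceEdge, slice, coordSubspace]
  constructor
  · rintro ⟨h1, h2⟩ i hi
    by_cases h0 : (i : ℕ) = 0
    · exact h2 i h0
    · exact h1 i (not_lt.1 fun h => hi ⟨h, h0⟩)
  · intro h
    exact ⟨fun i hi => h i fun h' => absurd h'.1 (not_lt.2 hi), fun i hi => h i fun h' => h'.2 hi⟩

theorem span_sliceCone : Submodule.span ℝ (sliceCone L k : Set (E L)) =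
    coordSubspace L {i | (i : ℕ) < k} := by
  change Submodule.span ℝ (slice L k) = _
  rw [slice_eq_coordSubspace, Submodule.span_eq]

theorem span_sliceEdgeCone : Submodule.span ℝ (sliceEdgeCone L k : Set (E L)) =
    coordSubspace L {i | (i : ℕ) < k ∧ (i : ℕ) ≠ 0} := by
  change Submodule.span ℝ (sliceEdge L k) = _
  rw [sliceEdge_eq_coordSubspace, Submodule.span_eq]

/-- The vector of `ℝ^L` that spans the direction transversal to the edge of the half slices. -/
def edgeNormal (L : ℕ) : E L := WithLp.toLp 2 fun i => if (i : ℕ) = 0 then 1 else 0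

theorem edgeNormal_mem (hk : 0 < k) : edgeNormal L ∈ halfSlice L k :=
  ⟨fun i hi => by simp [edgeNormal, show (i : ℕ) ≠ 0 by omega],
    fun i hi => by simp [edgeNormal, hi]⟩

theorem span_halfSliceCone (hk : 0 < k) : Submodule.span ℝ (halfSliceCone L k : Set (E L)) =
    coordSubspace L {i | (i : ℕ) < k} := by
  change Submodule.span ℝ (halfSlice L k) = _
  refine le_antisymm (Submodule.span_le.2 fun y hy => ?_) fun y hy => ?_
  · rw [← slice_eq_coordSubspace]; exact hy.1
  · have hy' : y ∈ slice L k := by rw [slice_eq_coordSubspace]; exact hy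
    by_cases hL : 0 < L
    · let i₀ : Fin L := ⟨0, hL⟩
      -- Adding |y₀| times the transversal direction pushes y into the half slice; within the span
      -- it can be subtracted again.
      have h1 : y + |y i₀| • edgeNormal L ∈ halfSlice L k := by
        refine ⟨(sliceCone L k).add_mem hy'
          ((sliceCone L k).smul_mem ⟨|y i₀|, abs_nonneg _⟩ (edgeNormal_mem hk).1), fun i hi => ?_⟩
        have : i = i₀ := Fin.ext hi
        subst this
        simp only [PiLp.add_apply, PiLp.smul_apply, edgeNormal, hi]
        simpa using (neg_le_iff_add_nonneg.1 (neg_abs_le (y i₀)))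
      have := Submodule.sub_mem _ (Submodule.subset_span h1)
        (Submodule.smul_mem _ |y i₀| (Submodule.subset_span (R := ℝ) (edgeNormal_mem (L := L) hk)))
      simpa using this
    · obtain rfl : L = 0 := by omega
      exact (Subsingleton.elim y 0) ▸ Submodule.zero_mem _

theorem natCard_lt (hk : k ≤ L) : Nat.card {i : Fin L | (i : ℕ) < k} = k := by
  rw [Nat.card_congr (β := Fin k) ⟨fun i => ⟨i.1, i.2⟩, fun j => ⟨⟨j, by omega⟩, j.2⟩,
    fun _ => rfl, fun _ => rfl⟩, Nat.card_fin]

theorem natCard_lt_ne (hk : k + 1 ≤ L) :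
    Nat.card {i : Fin L | (i : ℕ) < k + 1 ∧ (i : ℕ) ≠ 0} = k := by
  let f : {i : Fin L | (i : ℕ) < k + 1 ∧ (i : ℕ) ≠ 0} ≃ Fin k :=
    { toFun := fun i => ⟨(i : Fin L) - 1, by have h1 := i.2.1; have h2 := i.2.2; omega⟩
      invFun := fun j => ⟨⟨j + 1, by omega⟩, ⟨by simp, by simp⟩⟩
      left_inv := fun i => Subtype.ext (Fin.ext (by have h2 := i.2.2; dsimp; omega))
      right_inv := fun j => by simp }
  rw [Nat.card_congr f, Nat.card_fin]

end models

/-- At a point of its lineality space, a closed cone is its own positive tangent cone. -/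
theorem posTangentConeAt_cone {V : Type*} [NormedAddCommGroup V] [NormedSpace ℝ V]
    (C : Submodule NNReal V) (hC : IsClosed (C : Set V)) {x : V} (hx : x ∈ C) (hx' : -x ∈ C) :
    posTangentConeAt (C : Set V) x = C := by
  refine Subset.antisymm (fun y hy => ?_) (cone_subset_posTangentConeAt C hx)
  obtain ⟨ι, l, hl, c, d, hd₀, hds, hcd⟩ := exists_fun_of_mem_tangentConeAt hy
  refine hC.mem_of_tendsto hcd ?_
  filter_upwards [hds] with n hn
  refine C.smul_mem _ ?_
  simpa using C.add_mem hx' hn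

/-! ### Submanifolds with boundary -/

section submanifold

variable {L k : ℕ} {S B : Set (E L)}

theorem IsSubmanifoldWithBoundary.isSmoothPiece (h : IsSubmanifoldWithBoundary k S B) :
    IsSmoothPiece k S := by
  intro p hp
  obtain ⟨e, hpe, he, he', h1 | h2⟩ := h.exists_chart p hp
  · refine ⟨e, sliceCone L k, hpe, ⟨he, he', isClosed_slice L k, fun x hx => (h1 x hx).1⟩, ?_⟩
    rw [span_sliceCone, finrank_coordSubspace, natCard_lt h.dim_le]
  · refine ⟨e, halfSliceCone L k, hpe, ⟨he, he', isClosed_halfSlice L k, fun x hx => (h2 x hx).1⟩, ?_⟩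
    rw [span_halfSliceCone h.dim_pos, finrank_coordSubspace, natCard_lt h.dim_le]

theorem IsSubmanifoldWithBoundary.exists_boundary_chart (h : IsSubmanifoldWithBoundary k S B)
    {p : E L} (hp : p ∈ B) : ∃ e : OpenPartialHomeomorph (E L) (E L), p ∈ e.source ∧
      IsConeChart S e (halfSliceCone L k) ∧ IsConeChart B e (sliceEdgeCone L k) := by
  obtain ⟨e, hpe, he, he', h1 | h2⟩ := h.exists_chart p (h.boundary_subset hp)
  · exact absurd hp (h1 p hpe).2
  · exact ⟨e, hpe, ⟨he, he', isClosed_halfSlice L k, fun x hx => (h2 x hx).1⟩,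
      ⟨he, he', isClosed_sliceEdge L k, fun x hx => (h2 x hx).2⟩⟩

theorem IsSubmanifoldWithBoundary.isSmoothPiece_boundary
    (h : IsSubmanifoldWithBoundary k S B) : IsSmoothPiece (k - 1) B := by
  intro p hp
  obtain ⟨e, hpe, -, he⟩ := h.exists_boundary_chart hp
  obtain ⟨m, rfl⟩ : ∃ m, k = m + 1 := ⟨k - 1, by have := h.dim_pos; omega⟩
  exact ⟨e, _, hpe, he, by
    rw [span_sliceEdgeCone, finrank_coordSubspace, natCard_lt_ne h.dim_le]; rfl⟩

theorem neg_mem_slice {y : E L} (hy : y ∈ slice L k) : -y ∈ slice L k :=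
  fun i hi => by simp [hy i hi]

theorem neg_mem_sliceEdge {y : E L} (hy : y ∈ sliceEdge L k) : -y ∈ sliceEdge L k :=
  ⟨neg_mem_slice hy.1, fun i hi => by simp [hy.2 i hi]⟩

theorem sliceEdge_subset_halfSlice : sliceEdge L k ⊆ halfSlice L k :=
  fun _ hy => ⟨hy.1, fun i hi => (hy.2 i hi).ge⟩

theorem posTangentConeAt_halfSliceCone {y : E L} (hy : y ∈ sliceEdge L k) :
    posTangentConeAt (halfSliceCone L k : Set (E L)) y = halfSlice L k :=
  posTangentConeAt_cone _ (isClosed_halfSlice L k) (sliceEdge_subset_halfSlice hy)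
    (sliceEdge_subset_halfSlice (neg_mem_sliceEdge hy))

/-- Off the edge y₀ > 0, so the inequality stays valid along y - tv for small t > 0 and only the
linear conditions of the slice matter. -/
theorem neg_mem_posTangentConeAt_halfSlice {y v : E L} (hy : y ∈ halfSlice L k)
    (hy' : y ∉ sliceEdge L k) (hv : v ∈ posTangentConeAt (halfSliceCone L k : Set (E L)) y) :
    -v ∈ posTangentConeAt (halfSliceCone L k : Set (E L)) y := by
  have hv' : v ∈ slice L k := by
    rw [← show posTangentConeAt (sliceCone L k : Set (E L)) y = slice L k from
      posTangentConeAt_cone _ (isClosed_slice L k) hy.1 (neg_mem_slice hy.1)]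
    exact posTangentConeAt_mono (fun _ h => h.1) hv
  have hpos : ∀ i : Fin L, (i : ℕ) = 0 → 0 < y i := by
    intro i hi
    refine lt_of_le_of_ne (hy.2 i hi) fun h0 => hy' ⟨hy.1, fun j hj => ?_⟩
    rw [show j = i from Fin.ext (hj.trans hi.symm), ← h0]
  apply mem_posTangentConeAt_of_frequently_mem
  apply Eventually.frequently
  have hev : ∀ᶠ t : ℝ in 𝓝[>] 0, ∀ i : Fin L, (i : ℕ) = 0 → 0 < (y + t • -v) i := by
    rw [eventually_all]
    intro i
    by_cases hi : (i : ℕ) = 0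
    · have hc : Continuous fun t : ℝ => (y + t • -v) i := by fun_prop
      have : ∀ᶠ t : ℝ in 𝓝 0, 0 < (y + t • -v) i :=
        hc.continuousAt.eventually (lt_mem_nhds (by simpa using hpos i hi))
      filter_upwards [mem_nhdsWithin_of_mem_nhds this] with t ht _ using ht
    · exact Eventually.of_forall fun t h => absurd h hi
  filter_upwards [hev] with t ht
  exact ⟨fun i hi => by simp [hy.1 i hi, hv' i hi], fun i hi => (ht i hi).le⟩

/-- The boundary of a submanifold is determined by the submanifold. -/
theorem IsSubmanifoldWithBoundary.mem_boundary_iff (h : IsSubmanifoldWithBoundary k S B)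
    {p : E L} (hp : p ∈ S) :
    p ∈ B ↔ ∃ v ∈ posTangentConeAt S p, -v ∉ posTangentConeAt S p := by
  constructor
  · intro hpB
    obtain ⟨e, hpe, he, he'⟩ := h.exists_boundary_chart hpB
    have hedge : e p ∈ sliceEdge L k := (he'.mem_iff p hpe).1 hpB
    -- The inward coordinate direction of the chart lies in the cone, while its negative has zeroth
    -- coordinate -1.
    refine ⟨fderiv ℝ e.symm (e p) (edgeNormal L), ?_, ?_⟩
    · rw [he.mem_posTangentConeAt_iff hpe, he.fderiv_apply_fderiv_symm hpe,
        posTangentConeAt_halfSliceCone hedge]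
      exact edgeNormal_mem h.dim_pos
    · rw [he.mem_posTangentConeAt_iff hpe, map_neg, he.fderiv_apply_fderiv_symm hpe,
        posTangentConeAt_halfSliceCone hedge]
      intro hn
      have := hn.2 ⟨0, h.dim_pos.trans_le h.dim_le⟩ rfl
      simp [edgeNormal] at this
      linarith
  · rintro ⟨v, hv, hv'⟩
    obtain ⟨e, hpe, he, he', h1 | h2⟩ := h.exists_chart p hp
    · have hc : IsConeChart S e (sliceCone L k) :=
        ⟨he, he', isClosed_slice L k, fun x hx => (h1 x hx).1⟩
      have hep : e p ∈ slice L k := (hc.mem_iff p hpe).1 hp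
      have : posTangentConeAt (sliceCone L k : Set (E L)) (e p) = slice L k :=
        posTangentConeAt_cone _ (isClosed_slice L k) hep (neg_mem_slice hep)
      rw [hc.mem_posTangentConeAt_iff hpe, this] at hv hv'
      rw [map_neg] at hv'
      exact absurd (neg_mem_slice hv) hv'
    · have hc : IsConeChart S e (halfSliceCone L k) :=
        ⟨he, he', isClosed_halfSlice L k, fun x hx => (h2 x hx).1⟩
      rw [(h2 p hpe).2]
      by_contra hne
      rw [hc.mem_posTangentConeAt_iff hpe] at hv hv'
      rw [map_neg] at hv'
      exact hv' (neg_mem_posTangentConeAt_halfSlice ((h2 p hpe).1.1 hp) hne hv)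

/-- An isometry that preserves S carries positive tangent cones to positive tangent cones, hence
preserves the set of points where they are asymmetric. This yields the G-invariance of ∂M and ∂Σ. -/
theorem IsSubmanifoldWithBoundary.image_boundary (h : IsSubmanifoldWithBoundary k S B)
    {φ : E L ≃ₗᵢ[ℝ] E L} (hφ : φ '' S = S) : φ '' B = B := by
  have key : ∀ ψ : E L ≃ₗᵢ[ℝ] E L, ψ '' S = S → ∀ p ∈ B, ψ p ∈ B := by
    intro ψ hψ p hp
    have hpS := h.boundary_subset hp
    obtain ⟨v, hv, hv'⟩ := (h.mem_boundary_iff hpS).1 hp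
    refine (h.mem_boundary_iff (apply_mem_of_image_eq hψ hpS)).2
      ⟨ψ v, apply_mem_posTangentConeAt hψ hv, fun hn => hv' ?_⟩
    have := apply_mem_posTangentConeAt (image_symm_eq hψ) hn
    simpa using this
  refine Subset.antisymm (image_subset_iff.2 (key φ hφ)) fun p hp => ?_
  exact ⟨φ.symm p, key φ.symm (image_symm_eq hφ) p hp, φ.apply_symm_apply p⟩

theorem IsSubmanifoldWithBoundary.mem_boundary_of_mem_closure
    (h : IsSubmanifoldWithBoundary k S B) {p : E L} (hp : p ∈ S) (hpB : p ∈ closure B) :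
    p ∈ B := by
  obtain ⟨e, hpe, he, he', h1 | h2⟩ := h.exists_chart p hp
  · obtain ⟨x, hx, hxB⟩ := mem_closure_iff.1 hpB _ e.open_source hpe
    exact absurd hxB (h1 x hx).2
  · rw [(h2 p hpe).2]
    refine (isClosed_sliceEdge L k).closure_subset ?_
    have hc : ContinuousAt e p := e.continuousAt hpe
    rw [mem_closure_iff_frequently] at hpB ⊢
    refine hc.frequently ?_
    refine (hpB.and_eventually (e.open_source.mem_nhds hpe)).mono ?_
    rintro x ⟨hx, hx'⟩
    exact (h2 x hx').2.1 hx

/-- The boundary is relatively closed in the submanifold. This makes the boundary integrals of the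
second variation integrals over compact sets. -/
theorem IsSubmanifoldWithBoundary.isCompact_boundary_inter
    (h : IsSubmanifoldWithBoundary k S B) {K : Set (E L)} (hK : IsCompact (S ∩ K)) :
    IsCompact (B ∩ K) := by
  refine hK.of_isClosed_subset ?_ (inter_subset_inter_left _ h.boundary_subset)
  refine isClosed_of_closure_subset fun p hp => ?_
  have hpK : p ∈ S ∩ K := hK.isClosed.closure_subset
    (closure_mono (inter_subset_inter_left _ h.boundary_subset) hp)
  exact ⟨h.mem_boundary_of_mem_closure hpK.1 (closure_mono inter_subset_left hp), hpK.2⟩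

end submanifold

/-! ### Measure -/

section measure

variable {L k : ℕ} {A : Set (E L)}

theorem IsSmoothPiece.isLocallyClosed (hA : IsSmoothPiece k A) : IsLocallyClosed A := by
  refine ((isLocallyClosed_tfae A).out 0 3).2 fun p hp => ?_
  obtain ⟨e, C, hpe, h, -⟩ := hA p hp
  refine ⟨e.source, hpe, e.open_source, ?_⟩
  rintro x ⟨hxe, hxA⟩
  rw [h.mem_iff x hxe]
  refine h.isClosed.closure_subset ?_
  rw [mem_closure_iff_frequently] at hxA ⊢
  refine (e.continuousAt hxe).frequently ?_
  refine (hxA.and_eventually (e.open_source.mem_nhds hxe)).mono ?_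
  rintro y ⟨hy, hy'⟩
  exact (h.mem_iff y hy').1 hy

theorem IsSmoothPiece.measurableSet (hA : IsSmoothPiece k A) : MeasurableSet A := by
  obtain ⟨U, Z, hU, hZ, rfl⟩ := hA.isLocallyClosed
  exact hU.measurableSet.inter hZ.measurableSet

/-- `μHE` is a finite nonzero multiple of `μH`, so finiteness passes to `μH`, where the Lipschitz
estimate is available, and back. -/
theorem _root_.LipschitzOnWith.euclideanHausdorffMeasure_image_lt_top {f : E L → E L} {K : NNReal}
    {s t : Set (E L)} (hf : LipschitzOnWith K f s) (hts : t ⊆ s)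
    (ht : (μHE[k] : Measure (E L)) t < ⊤) : (μHE[k] : Measure (E L)) (f '' t) < ⊤ := by
  have h1 : (μH[k] : Measure (E L)) t < ⊤ := by
    by_contra hne
    rw [not_lt, top_le_iff] at hne
    rw [Measure.euclideanHausdorffMeasure_def, Measure.smul_apply, hne,
      ENNReal.smul_top] at ht
    simp [Measure.addHaarScalarFactor_volume_hausdorffMeasure_ne_zero] at ht
  have h2 := (hf.mono hts).hausdorffMeasure_image_le (d := k) (by positivity)
  have h3 : (μH[k] : Measure (E L)) (f '' t) < ⊤ :=
    h2.trans_lt (ENNReal.mul_lt_top (by simp) h1)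
  rw [Measure.euclideanHausdorffMeasure_def, Measure.smul_apply]
  exact ENNReal.mul_lt_top ENNReal.coe_lt_top h3

theorem euclideanHausdorffMeasure_submodule_inter_ball_lt_top (V : Submodule ℝ (E L)) {x : E L}
    (hx : x ∈ V) (r : ℝ) :
    (μHE[Module.finrank ℝ V] : Measure (E L)) (V ∩ Metric.ball x r) < ⊤ := by
  have h1 : (V : Set (E L)) ∩ Metric.ball x r = Subtype.val '' (Metric.ball (⟨x, hx⟩ : V) r) := by
    ext y
    simp only [mem_inter_iff, Metric.mem_ball, mem_image, Subtype.exists, exists_and_right,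
      exists_eq_right]
    exact ⟨fun h => ⟨h.1, h.2⟩, fun ⟨h, h'⟩ => ⟨h, h'⟩⟩
  rw [h1, isometry_subtype_coe.euclideanHausdorffMeasure_image,
    InnerProductSpace.euclideanHausdorffMeasure_eq_volume]
  exact measure_ball_lt_top

/-- Near p the set is contained in the image, under the locally Lipschitz inverse chart, of a ball
in the k-dimensional span of the model cone. -/
theorem IsSmoothPiece.finiteAtFilter (hA : IsSmoothPiece k A) {p : E L} (hp : p ∈ A) :
    (μHE[k] : Measure (E L)).FiniteAtFilter (𝓝[A] p) := by
  obtain ⟨e, C, hpe, h, rfl⟩ := hA p hp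
  have hep : e p ∈ Submodule.span ℝ (C : Set (E L)) :=
    Submodule.subset_span ((h.mem_iff p hpe).1 hp)
  have hc : ContDiffAt ℝ 1 e.symm (e p) :=
    (h.smooth_symm.contDiffAt (e.open_target.mem_nhds (e.map_source hpe))).of_le (by simp)
  obtain ⟨K, t, ht, hK⟩ := hc.exists_lipschitzOnWith
  obtain ⟨r, hr, hrt⟩ := Metric.mem_nhds_iff.1 ht
  have hball : ∀ᶠ x in 𝓝 p, e x ∈ Metric.ball (e p) r :=
    (e.continuousAt hpe).eventually (Metric.ball_mem_nhds _ hr)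
  refine ⟨{x | x ∈ A ∧ x ∈ e.source ∧ e x ∈ Metric.ball (e p) r}, ?_, ?_⟩
  · filter_upwards [self_mem_nhdsWithin, mem_nhdsWithin_of_mem_nhds hball,
      mem_nhdsWithin_of_mem_nhds (e.open_source.mem_nhds hpe)] with x h1 h2 h3 using ⟨h1, h3, h2⟩
  · refine (measure_mono ?_).trans_lt (hK.euclideanHausdorffMeasure_image_lt_top
      (inter_subset_right.trans hrt)
      (euclideanHausdorffMeasure_submodule_inter_ball_lt_top _ hep r))
    rintro x ⟨hxA, hxe, hxb⟩
    exact ⟨e x, ⟨Submodule.subset_span ((h.mem_iff x hxe).1 hxA), hxb⟩, e.left_inv hxe⟩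

theorem IsSmoothPiece.measure_lt_top (hA : IsSmoothPiece k A) {K : Set (E L)} (hK : IsCompact K)
    (hKA : K ⊆ A) : (μHE[k] : Measure (E L)) K < ⊤ :=
  hK.measure_lt_top_of_nhdsWithin fun p hp =>
    (hA.finiteAtFilter (hKA hp)).filter_mono (nhdsWithin_mono p hKA)

end measure

/-! ### Gluing local smooth extensions -/

section extension

variable {L k n : ℕ} {A : Set (E L)} {W : Type*} [NormedAddCommGroup W] [NormedSpace ℝ W]

theorem smoothAlong_of_local {F : E L → W}
    (h : ∀ p ∈ A, ∃ O : Set (E L), IsOpen O ∧ p ∈ O ∧ SmoothAlong (A ∩ O) F) : SmoothAlong A F := by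
  intro p hp
  obtain ⟨O, hO, hpO, hF⟩ := h p hp
  obtain ⟨O', hO', hpO', F', hF', he⟩ := hF p ⟨hp, hpO⟩
  exact ⟨O ∩ O', hO.inter hO', ⟨hpO, hpO'⟩, F', hF'.mono inter_subset_right,
    fun x hx => he ⟨⟨hx.1, hx.2.1⟩, hx.2.2⟩⟩

theorem SmoothAlong.normalize {F : E L → E L} (hF : SmoothAlong A F) (h0 : ∀ p ∈ A, F p ≠ 0) :
    SmoothAlong A (fun p => ‖F p‖⁻¹ • F p) := by
  intro p hp
  obtain ⟨O, hO, hpO, F', hF', he⟩ := hF p hp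
  have hO' : IsOpen (O ∩ F' ⁻¹' {0}ᶜ) :=
    hF'.continuousOn.isOpen_inter_preimage hO isOpen_compl_singleton
  refine ⟨O ∩ F' ⁻¹' {0}ᶜ, hO', ⟨hpO, ?_⟩, fun x => ‖F' x‖⁻¹ • F' x, ?_, fun x hx => ?_⟩
  · rw [mem_preimage, ← he ⟨hp, hpO⟩]; exact h0 p hp
  · have h1 := hF'.mono (inter_subset_left : O ∩ F' ⁻¹' {0}ᶜ ⊆ O)
    exact ((h1.norm ℝ fun x hx => hx.2).inv fun x hx => norm_ne_zero_iff.2 hx.2).smul h1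
  · dsimp only; rw [he ⟨hx.1, hx.2.1⟩]

/-- A function with local smooth extensions that vanishes off a closed subset of `A` is the
restriction of a smooth function. -/
theorem SmoothAlong.exists_contDiff {F : E L → W} (hF : SmoothAlong A F) {K : Set (E L)}
    (hK : IsClosed K) (hKA : K ⊆ A) (h0 : ∀ p ∈ A, p ∉ K → F p = 0) :
    ∃ Φ : E L → W, ContDiff ℝ ∞ Φ ∧ EqOn Φ F A := by
  classical
  -- The prescribed values form a single point on A and impose nothing elsewhere. Both constraints
  -- are convex, so a partition of unity glues local solutions.
  let t : E L → Set W := fun x => {y | x ∈ A → y = F x}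
  have ht : ∀ x, Convex ℝ (t x) := by
    intro x
    by_cases hx : x ∈ A
    · have : t x = {F x} := by ext y; simp [t, hx]
      rw [this]; exact convex_singleton _
    · have : t x = univ := by ext y; simp [t, hx]
      rw [this]; exact convex_univ
  obtain ⟨g, hg⟩ := exists_contMDiffMap_forall_mem_convex_of_local (n := (⊤ : ℕ∞))
    (modelWithCornersSelf ℝ (E L)) ht (by
      intro x
      by_cases hx : x ∈ A
      · obtain ⟨O, hO, hpO, F', hF', he⟩ := hF x hx
        exact ⟨O, hO.mem_nhds hpO, F', hF'.contMDiffOn, fun y hy hyA => (he ⟨hyA, hy⟩).symm⟩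
      -- The point may be a limit of points of A, but near it F vanishes on A, so the zero function
      -- is a local solution.
      · exact ⟨Kᶜ, hK.isOpen_compl.mem_nhds fun h => hx (hKA h), fun _ => 0,
          contMDiffOn_const, fun y hy hyA => (h0 y hyA hy).symm⟩)
  exact ⟨g, g.contMDiff.contDiff, fun x hx => hg x hx⟩

end extension

/-! ### Unit normals of hypersurfaces -/

section normals

variable {L k n : ℕ}

/-- The dimension count gives T' = T ⊕ ℝv orthogonally. -/
theorem sub_starProjection_eq {T T' : Submodule ℝ (E L)} (hT : T ≤ T')
    (hd : Module.finrank ℝ T' = Module.finrank ℝ T + 1) {v : E L} (hv : v ∈ T') (hv1 : ‖v‖ = 1)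
    (hvT : ∀ w ∈ T, inner ℝ v w = 0) {w : E L} (hw : w ∈ T') :
    w - T.starProjection w = inner ℝ v w • v := by
  have hv0 : v ≠ 0 := by rintro rfl; simp at hv1
  have hdis : T ⊓ Submodule.span ℝ {v} = ⊥ := by
    rw [Submodule.eq_bot_iff]
    rintro x ⟨hx, hx'⟩
    obtain ⟨c, rfl⟩ := Submodule.mem_span_singleton.1 hx'
    have := hvT _ hx
    rw [inner_smul_right, real_inner_self_eq_norm_sq, hv1] at this
    have hc : c = 0 := by simpa using this
    simp [hc]
  have hsup : T ⊔ Submodule.span ℝ {v} = T' := by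
    refine Submodule.eq_of_le_of_finrank_eq (sup_le hT (by simpa using hv)) ?_
    have := Submodule.finrank_sup_add_finrank_inf_eq T (Submodule.span ℝ {v})
    rw [hdis, finrank_bot, finrank_span_singleton hv0] at this
    omega
  rw [← hsup] at hw
  obtain ⟨a, ha, b, hb, rfl⟩ := Submodule.mem_sup.1 hw
  obtain ⟨c, rfl⟩ := Submodule.mem_span_singleton.1 hb
  have h1 : T.starProjection (a + c • v) = a := by
    refine Submodule.eq_starProjection_of_mem_of_inner_eq_zero ha fun w hw => ?_
    rw [add_sub_cancel_left, inner_smul_left, hvT w hw, mul_zero]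
  rw [h1, inner_add_right, hvT a ha, inner_smul_right, real_inner_self_eq_norm_sq, hv1]
  simp

theorem tangentSp_mono {A B : Set (E L)} (h : A ⊆ B) (p : E L) : tangentSp A p ≤ tangentSp B p :=
  Submodule.span_mono (tangentConeAt_mono h)

variable {M S : Set (E L)}

theorem IsUnitNormal.sub_tangentProj_eq {ν : E L → E L} (hν : IsUnitNormal M S ν)
    (hM : IsSmoothPiece (n + 1) M) (hS : IsSmoothPiece n S) (hSM : S ⊆ M) {p : E L} (hp : p ∈ S)
    {w : E L} (hw : w ∈ tangentSp M p) : w - tangentProj S p w = inner ℝ (ν p) w • ν p := by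
  refine sub_starProjection_eq (tangentSp_mono hSM p) ?_ (hν.mem_tangent p hp) (hν.norm_eq p hp)
    (hν.orthogonal p hp) hw
  rw [hM.finrank_tangentSp (hSM hp), hS.finrank_tangentSp hp]

/-- An ambient extension of ν is built from the continuity of ν and the smoothness of the
projections. For q near p the part of P_M ν(p) orthogonal to T_qS is ⟨ν(q), ν(p)⟩ ν(q), with
positive coefficient. This vector has a smooth extension because the projections do, and normalising
it returns ν(q). -/
theorem IsUnitNormal.smoothAlong {ν : E L → E L} (hν : IsUnitNormal M S ν)
    (hM : IsSmoothPiece (n + 1) M) (hS : IsSmoothPiece n S) (hSM : S ⊆ M) : SmoothAlong S ν := by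
  refine smoothAlong_of_local fun p hp => ?_
  have hc : ContinuousOn (fun q => inner ℝ (ν q) (ν p)) S :=
    hν.smooth.continuousOn.inner continuousOn_const
  obtain ⟨O, hO, hOS⟩ := continuousOn_iff'.1 hc (Ioi 0) isOpen_Ioi
  have hpO : p ∈ O := by
    have : p ∈ (fun q => inner ℝ (ν q) (ν p)) ⁻¹' (Ioi 0) ∩ S := by
      refine ⟨?_, hp⟩
      simp [hν.norm_eq p hp]
    rw [hOS] at this
    exact this.1
  refine ⟨O, hO, hpO, ?_⟩
  have hpos : ∀ q ∈ S ∩ O, 0 < inner ℝ (ν q) (ν p) := fun q hq =>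
    (hOS.symm ▸ (⟨hq.2, hq.1⟩ : q ∈ O ∩ S) :
      q ∈ (fun q => inner ℝ (ν q) (ν p)) ⁻¹' (Ioi 0) ∩ S).1
  let F : E L → E L := fun q => tangentProj M q (ν p) - tangentProj S q (tangentProj M q (ν p))
  have hPM := hM.smoothAlong_tangentProj.mono (inter_subset_left.trans hSM : S ∩ O ⊆ M)
  have hPS := hS.smoothAlong_tangentProj.mono (inter_subset_left : S ∩ O ⊆ S)
  have hconst : SmoothAlong (S ∩ O) fun _ => ν p := contDiff_const.smoothAlong _
  have hF : SmoothAlong (S ∩ O) F :=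
    (hPM.clm_apply hconst).map₂ (hPS.clm_apply (hPM.clm_apply hconst))
      (Φ := fun x => x.1 - x.2) (contDiff_fst.sub contDiff_snd)
  have hFe : ∀ q ∈ S ∩ O, F q = inner ℝ (ν q) (ν p) • ν q := by
    intro q hq
    have h1 := hν.sub_tangentProj_eq hM hS hSM hq.1 (tangentProj_mem M q (ν p))
    have h2 : inner ℝ (ν q) (tangentProj M q (ν p)) = inner ℝ (ν q) (ν p) := by
      have := Submodule.starProjection_inner_eq_zero (K := tangentSp M q) (ν p) _
        (hν.mem_tangent q hq.1)
      rw [inner_sub_left, sub_eq_zero, real_inner_comm, real_inner_comm (ν q)] at this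
      exact this.symm
    rw [h2] at h1
    exact h1
  have hne : ∀ q ∈ S ∩ O, F q ≠ 0 := by
    intro q hq h0
    have := congrArg (‖·‖) ((hFe q hq).symm.trans h0)
    simp only [norm_smul, hν.norm_eq q hq.1, mul_one, norm_zero, norm_eq_zero] at this
    exact (hpos q hq).ne' this
  refine (hF.normalize hne).congr fun q hq => ?_
  have h := hpos q hq
  dsimp only
  rw [hFe q hq, norm_smul, hν.norm_eq q hq.1, mul_one, smul_smul, Real.norm_of_nonneg h.le,
    inv_mul_cancel₀ h.ne', one_smul]

theorem IsUnitNormal.eq_or_eq_neg {ν ν' : E L → E L} (hν : IsUnitNormal M S ν)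
    (hν' : IsUnitNormal M S ν') (hM : IsSmoothPiece (n + 1) M) (hS : IsSmoothPiece n S)
    (hSM : S ⊆ M) {p : E L} (hp : p ∈ S) : ν' p = inner ℝ (ν p) (ν' p) • ν p ∧
      (inner ℝ (ν p) (ν' p) = 1 ∨ inner ℝ (ν p) (ν' p) = -1) := by
  have h1 := hν.sub_tangentProj_eq hM hS hSM hp (hν'.mem_tangent p hp)
  have h2 : tangentProj S p (ν' p) = 0 :=
    Submodule.eq_starProjection_of_mem_of_inner_eq_zero (Submodule.zero_mem _)
      fun w hw => by rw [sub_zero]; exact hν'.orthogonal p hp w hw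
  rw [h2, sub_zero] at h1
  refine ⟨h1, ?_⟩
  have h3 := congrArg (‖·‖) h1
  simp only [norm_smul, hν.norm_eq p hp, hν'.norm_eq p hp, mul_one, Real.norm_eq_abs] at h3
  exact eq_or_eq_neg_of_abs_eq h3.symm

/-! ### The inward unit normal -/

variable {dM : Set (E L)}

theorem IsInwardUnitNormalAt.map {φ : E L ≃ₗᵢ[ℝ] E L} (hφ : φ '' M = M) (hφ' : φ '' dM = dM)
    {p v : E L} (h : IsInwardUnitNormalAt M dM p v) : IsInwardUnitNormalAt M dM (φ p) (φ v) := by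
  refine ⟨by rw [φ.norm_map]; exact h.1, apply_mem_tangentSp hφ h.2.1, fun w hw => ?_,
    apply_mem_posTangentConeAt hφ h.2.2.2⟩
  obtain ⟨w, rfl⟩ := φ.surjective w
  rw [φ.inner_map_map]
  exact h.2.2.1 w ((apply_mem_tangentSp_iff hφ').1 hw)

theorem tangentSp_boundary_le {k : ℕ} (hM : IsSubmanifoldWithBoundary k M dM) (p : E L) :
    tangentSp dM p ≤ tangentSp M p := tangentSp_mono hM.boundary_subset p

theorem mem_posTangentConeAt_iff_halfSlice {k : ℕ} {e : OpenPartialHomeomorph (E L) (E L)}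
    (h : IsConeChart M e (halfSliceCone L k)) (h' : IsConeChart dM e (sliceEdgeCone L k))
    {p : E L} (hpe : p ∈ e.source) (hp : p ∈ dM) {v : E L} :
    v ∈ posTangentConeAt M p ↔ fderiv ℝ e p v ∈ halfSlice L k := by
  rw [h.mem_posTangentConeAt_iff hpe, posTangentConeAt_halfSliceCone ((h'.mem_iff p hpe).1 hp)]

section chart

variable {k : ℕ} (hM : IsSubmanifoldWithBoundary k M dM) {e : OpenPartialHomeomorph (E L) (E L)}
  (h : IsConeChart M e (halfSliceCone L k)) (h' : IsConeChart dM e (sliceEdgeCone L k))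
  {p : E L} (hpe : p ∈ e.source) (hp : p ∈ dM)

include hM h h' hpe hp

theorem mem_tangentSp_boundary_iff (i₀ : Fin L) (hi₀ : (i₀ : ℕ) = 0) {v : E L}
    (hv : v ∈ tangentSp M p) : v ∈ tangentSp dM p ↔ (fderiv ℝ e p v) i₀ = 0 := by
  rw [h.mem_tangentSp_iff hpe (hM.boundary_subset hp), span_halfSliceCone hM.dim_pos] at hv
  rw [h'.mem_tangentSp_iff hpe hp, span_sliceEdgeCone, ← SetLike.mem_coe,
    ← sliceEdge_eq_coordSubspace]
  rw [← SetLike.mem_coe, ← slice_eq_coordSubspace] at hv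
  refine ⟨fun hv => hv.2 i₀ hi₀, fun h0 => ⟨hv, fun i hi => ?_⟩⟩
  rwa [show i = i₀ from Fin.ext (hi.trans hi₀.symm)]

/-- The coordinate is nonnegative because v points into M; if it vanished, v would be tangent to ∂M
and hence orthogonal to itself. -/
theorem IsInwardUnitNormalAt.coord_pos (i₀ : Fin L) (hi₀ : (i₀ : ℕ) = 0) {v : E L}
    (hv : IsInwardUnitNormalAt M dM p v) : 0 < (fderiv ℝ e p v) i₀ := by
  refine lt_of_le_of_ne
    (((mem_posTangentConeAt_iff_halfSlice h h' hpe hp).1 hv.2.2.2).2 i₀ hi₀) fun h0 => ?_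
  have := hv.2.2.1 v ((mem_tangentSp_boundary_iff hM h h' hpe hp i₀ hi₀ hv.2.1).2 h0.symm)
  rw [real_inner_self_eq_norm_sq, hv.1] at this
  norm_num at this

theorem IsInwardUnitNormalAt.unique_of_chart {v w : E L} (hv : IsInwardUnitNormalAt M dM p v)
    (hw : IsInwardUnitNormalAt M dM p w) : v = w := by
  let i₀ : Fin L := ⟨0, hM.dim_pos.trans_le hM.dim_le⟩
  have ha := hv.coord_pos hM h h' hpe hp i₀ rfl
  have hb := hw.coord_pos hM h h' hpe hp i₀ rfl
  set a := (fderiv ℝ e p v) i₀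
  set b := (fderiv ℝ e p w) i₀
  -- The weights cancel the zeroth chart coordinate, so this combination is tangent to ∂M. It is
  -- also orthogonal to ∂M, hence zero; unit length and positive weights then force v = w.
  have hx : b • v - a • w ∈ tangentSp dM p := by
    rw [mem_tangentSp_boundary_iff hM h h' hpe hp i₀ rfl (Submodule.sub_mem _
      (Submodule.smul_mem _ _ hv.2.1) (Submodule.smul_mem _ _ hw.2.1))]
    simp only [map_sub, map_smul, PiLp.sub_apply, PiLp.smul_apply, smul_eq_mul]
    change b * a - a * b = 0
    ring
  have h0 : b • v - a • w = 0 := by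
    rw [← inner_self_eq_zero (𝕜 := ℝ)]
    nth_rewrite 1 [inner_sub_left]
    rw [inner_smul_left, inner_smul_left, hv.2.2.1 _ hx, hw.2.2.1 _ hx]
    simp
  have h1 : b • v = a • w := sub_eq_zero.1 h0
  have h2 := congrArg (‖·‖) h1
  simp only [norm_smul, hv.1, hw.1, mul_one, Real.norm_of_nonneg ha.le,
    Real.norm_of_nonneg hb.le] at h2
  rw [h2] at h1
  exact smul_right_injective _ ha.ne' h1

/-- The component of the coordinate direction `∂₀` of the chart that is normal to the boundary. -/
theorem isInwardUnitNormalAt_normalize :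
    let u := fderiv ℝ e.symm (e p) (edgeNormal L) -
      tangentProj dM p (fderiv ℝ e.symm (e p) (edgeNormal L))
    u ≠ 0 ∧ IsInwardUnitNormalAt M dM p (‖u‖⁻¹ • u) := by
  intro u
  let i₀ : Fin L := ⟨0, hM.dim_pos.trans_le hM.dim_le⟩
  have hpM := hM.boundary_subset hp
  set w := fderiv ℝ e.symm (e p) (edgeNormal L) with hw
  have hu : u = w - tangentProj dM p w := rfl
  have hDw : fderiv ℝ e p w = edgeNormal L := h.fderiv_apply_fderiv_symm hpe _
  have hwM : w ∈ tangentSp M p := by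
    rw [h.mem_tangentSp_iff hpe hpM, hDw]
    exact Submodule.subset_span (edgeNormal_mem hM.dim_pos)
  have hPM : tangentProj dM p w ∈ tangentSp M p :=
    tangentSp_boundary_le hM p (tangentProj_mem _ _ _)
  have huM : u ∈ tangentSp M p := Submodule.sub_mem _ hwM hPM
  have hu0 : (fderiv ℝ e p u) i₀ = 1 := by
    have h1 := (mem_tangentSp_boundary_iff hM h h' hpe hp i₀ rfl hPM).1 (tangentProj_mem _ _ _)
    rw [hu, map_sub, PiLp.sub_apply, h1, hDw, sub_zero]
    simp [i₀, edgeNormal]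
  have hune : u ≠ 0 := by
    intro h0
    rw [h0] at hu0
    simp at hu0
  have hnorm : 0 < ‖u‖ := norm_pos_iff.2 hune
  refine ⟨hune, ?_, Submodule.smul_mem _ _ huM, fun v hv => ?_, ?_⟩
  · rw [norm_smul, norm_inv, norm_norm, inv_mul_cancel₀ hnorm.ne']
  · rw [inner_smul_left, hu, tangentProj, Submodule.starProjection_inner_eq_zero _ _ hv, mul_zero]
  · rw [mem_posTangentConeAt_iff_halfSlice h h' hpe hp, map_smul]
    have huM' := huM
    rw [h.mem_tangentSp_iff hpe hpM, span_halfSliceCone hM.dim_pos, ← SetLike.mem_coe,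
      ← slice_eq_coordSubspace] at huM'
    refine (halfSliceCone L k).smul_mem ⟨‖u‖⁻¹, by positivity⟩ ⟨huM', fun i hi => ?_⟩
    rw [show i = i₀ from Fin.ext hi, hu0]
    exact zero_le_one

end chart

variable {k : ℕ}

theorem IsSubmanifoldWithBoundary.isInwardUnitNormalAt_inwardUnitNormal
    (hM : IsSubmanifoldWithBoundary k M dM) {p : E L} (hp : p ∈ dM) :
    IsInwardUnitNormalAt M dM p (inwardUnitNormal M dM p) := by
  obtain ⟨e, hpe, h, h'⟩ := hM.exists_boundary_chart hp
  exact Classical.epsilon_spec ⟨_, (isInwardUnitNormalAt_normalize hM h h' hpe hp).2⟩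

theorem IsSubmanifoldWithBoundary.eq_inwardUnitNormal
    (hM : IsSubmanifoldWithBoundary k M dM) {p v : E L} (hp : p ∈ dM)
    (hv : IsInwardUnitNormalAt M dM p v) : inwardUnitNormal M dM p = v := by
  obtain ⟨e, hpe, h, h'⟩ := hM.exists_boundary_chart hp
  exact (hM.isInwardUnitNormalAt_inwardUnitNormal hp).unique_of_chart hM h h' hpe hp hv

theorem IsSubmanifoldWithBoundary.inwardUnitNormal_apply
    (hM : IsSubmanifoldWithBoundary k M dM) {φ : E L ≃ₗᵢ[ℝ] E L} (hφ : φ '' M = M) {p : E L}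
    (hp : p ∈ dM) : inwardUnitNormal M dM (φ p) = φ (inwardUnitNormal M dM p) :=
  hM.eq_inwardUnitNormal (apply_mem_of_image_eq (hM.image_boundary hφ) hp)
    ((hM.isInwardUnitNormalAt_inwardUnitNormal hp).map hφ (hM.image_boundary hφ))

/-- By uniqueness the value chosen by `Classical.epsilon` agrees with the explicit normalised chart
direction, which varies smoothly. -/
theorem IsSubmanifoldWithBoundary.smoothAlong_inwardUnitNormal
    (hM : IsSubmanifoldWithBoundary k M dM) : SmoothAlong dM (inwardUnitNormal M dM) := by
  refine smoothAlong_of_local fun p hp => ?_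
  obtain ⟨e, hpe, h, h'⟩ := hM.exists_boundary_chart hp
  refine ⟨e.source, e.open_source, hpe, ?_⟩
  have h1 : SmoothAlong (dM ∩ e.source) fun q => fderiv ℝ e.symm (e q) (edgeNormal L) :=
    fun q hq => ⟨e.source, e.open_source, hq.2, _,
      ((h.smooth_symm.fderiv_of_isOpen e.open_target le_rfl).comp h.smooth e.mapsTo).clm_apply
        contDiffOn_const, fun _ _ => rfl⟩
  have h2 := (hM.isSmoothPiece_boundary.smoothAlong_tangentProj.mono
    (inter_subset_left : dM ∩ e.source ⊆ dM)).clm_apply h1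
  have h3 := h1.map₂ h2 (Φ := fun x => x.1 - x.2) (contDiff_fst.sub contDiff_snd)
  refine (h3.normalize fun q hq =>
    (isInwardUnitNormalAt_normalize hM h h' hq.2 hq.1).1).congr fun q hq => ?_
  exact hM.eq_inwardUnitNormal hq.1 (isInwardUnitNormalAt_normalize hM h h' hq.2 hq.1).2

end normals

set_option linter.unusedSectionVars false

/-! ### Parametric integrals over a compact space -/

section parametric

variable {G : Type*} [TopologicalSpace G] [CompactSpace G] [MeasurableSpace G] [BorelSpace G]
  {μ : Measure G} [IsFiniteMeasure μ] {L : ℕ}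

theorem integrable_of_continuous {W : Type*} [NormedAddCommGroup W] {f : G → W}
    (hf : Continuous f) : Integrable f μ :=
  hf.integrable_of_hasCompactSupport (HasCompactSupport.of_compactSpace f)

universe u

variable {W W' : Type u} [NormedAddCommGroup W] [NormedSpace ℝ W] [NormedAddCommGroup W']
  [NormedSpace ℝ W']

theorem hasFDerivAt_integral_comp {R : G → E L →L[ℝ] E L} (hR : Continuous R)
    {A : G → W →L[ℝ] W'} (hA : Continuous A) {Y : E L → W} (hY : ContDiff ℝ 1 Y) (x : E L) :
    HasFDerivAt (fun x => ∫ g, A g (Y (R g x)) ∂μ)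
      (∫ g, A g ∘L fderiv ℝ Y (R g x) ∘L R g ∂μ) x := by
  have hcont : Continuous fun z : E L × G => A z.2 ∘L fderiv ℝ Y (R z.2 z.1) ∘L R z.2 := by
    have h1 : Continuous fun z : E L × G => R z.2 z.1 :=
      (hR.comp continuous_snd).clm_apply continuous_fst
    exact (hA.comp continuous_snd).clm_comp
      (((hY.continuous_fderiv one_ne_zero).comp h1).clm_comp (hR.comp continuous_snd))
  have hF (x : E L) : Continuous fun g => A g (Y (R g x)) :=
    hA.clm_apply (hY.continuous.comp (hR.clm_apply continuous_const))
  -- Compactness of the ball times G makes a constant a dominating function.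
  obtain ⟨C, hC⟩ := ((isCompact_closedBall x 1).prod (isCompact_univ (X := G))).exists_bound_of_continuousOn
    hcont.continuousOn
  refine hasFDerivAt_integral_of_dominated_of_fderiv_le (𝕜 := ℝ) (bound := fun _ => C)
    (F' := fun x g => A g ∘L fderiv ℝ Y (R g x) ∘L R g)
    (Metric.closedBall_mem_nhds x one_pos)
    (Eventually.of_forall fun y => (integrable_of_continuous (hF y)).1)
    (integrable_of_continuous (hF x))
    (integrable_of_continuous (hcont.comp (Continuous.prodMk_right x))).1 ?_ (integrable_const C) ?_
  · exact Eventually.of_forall fun g y hy => hC (y, g) ⟨hy, mem_univ _⟩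
  · refine Eventually.of_forall fun g y _ => ?_
    exact (A g).hasFDerivAt.comp y
      (((hY.differentiable (by simp)) (R g y)).hasFDerivAt.comp y (R g).hasFDerivAt)

/-- The derivative of such an integral is an integral of the same shape with operator-valued data,
so the induction must run over all target spaces W and W' at once. -/
theorem contDiff_nat_integral_comp {R : G → E L →L[ℝ] E L} (hR : Continuous R) (n : ℕ) :
    ∀ {W W' : Type u} [NormedAddCommGroup W] [NormedSpace ℝ W] [NormedAddCommGroup W']
      [NormedSpace ℝ W'] {A : G → W →L[ℝ] W'} (_ : Continuous A) {Y : E L → W}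
      (_ : ContDiff ℝ ∞ Y), ContDiff ℝ n (fun x => ∫ g, A g (Y (R g x)) ∂μ) := by
  induction n with
  | zero =>
    intro W W' _ _ _ _ A hA Y hY
    rw [Nat.cast_zero, contDiff_zero]
    refine Differentiable.continuous (𝕜 := ℝ) fun x => ?_
    exact (hasFDerivAt_integral_comp hR hA (hY.of_le (by simp)) x).differentiableAt
  | succ n ih =>
    intro W W' _ _ _ _ A hA Y hY
    have hd := hasFDerivAt_integral_comp (μ := μ) hR hA (hY.of_le (by simp))
    rw [Nat.cast_succ, contDiff_succ_iff_fderiv]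
    refine ⟨fun x => (hd x).differentiableAt, by simp, ?_⟩
    have h1 : fderiv ℝ (fun x => ∫ g, A g (Y (R g x)) ∂μ) = fun x => ∫ g,
        ((ContinuousLinearMap.compL ℝ (E L) W W' (A g)) ∘L
          ((ContinuousLinearMap.compL ℝ (E L) (E L) W).flip (R g))) (fderiv ℝ Y (R g x)) ∂μ :=
      funext fun x => (hd x).fderiv
    rw [h1]
    refine ih ?_ (contDiff_infty_iff_fderiv.1 hY).2
    exact ((ContinuousLinearMap.continuous _).comp hA).clm_comp
      ((ContinuousLinearMap.continuous _).comp hR)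

theorem contDiff_integral_comp {R : G → E L →L[ℝ] E L} (hR : Continuous R)
    {A : G → W →L[ℝ] W'} (hA : Continuous A) {Y : E L → W} (hY : ContDiff ℝ ∞ Y) :
    ContDiff ℝ ∞ (fun x => ∫ g, A g (Y (R g x)) ∂μ) :=
  contDiff_infty.2 fun n => contDiff_nat_integral_comp hR n hA hY

end parametric

/-! ### Averages over the group -/

section average

variable {L : ℕ} {G : Type*} [Group G]

/-- The pointwise action of `g⁻¹` as a continuous linear map. -/
noncomputable abbrev invAct (ρ : G →* (E L ≃ₗᵢ[ℝ] E L)) (g : G) : E L →L[ℝ] E L :=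
  isomCLM (ρ g⁻¹)

variable {ρ : G →* (E L ≃ₗᵢ[ℝ] E L)}

@[simp]
theorem rho_inv_apply_rho_apply (g : G) (x : E L) : ρ g⁻¹ (ρ g x) = x := by
  rw [map_inv]; exact (ρ g).symm_apply_apply x

@[simp]
theorem rho_apply_rho_inv_apply (g : G) (x : E L) : ρ g (ρ g⁻¹ x) = x := by
  rw [map_inv]; exact (ρ g).apply_symm_apply x

theorem rho_mul_apply (g h : G) (x : E L) : ρ (g * h) x = ρ g (ρ h x) := by
  rw [map_mul]; rfl

/-- The union of the orbits that meet `K`. -/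
def saturation (ρ : G →* (E L ≃ₗᵢ[ℝ] E L)) (K : Set (E L)) : Set (E L) := {x | ∃ g, ρ g x ∈ K}

theorem saturation_invariant (K : Set (E L)) : IsGInvariant ρ (saturation ρ K) := by
  intro g
  ext x
  constructor
  · rintro ⟨y, ⟨h, hy⟩, rfl⟩
    exact ⟨h * g⁻¹, by rw [rho_mul_apply]; simpa using hy⟩
  · rintro ⟨h, hx⟩
    exact ⟨ρ g⁻¹ x, ⟨h * g, by rw [rho_mul_apply]; simpa using hx⟩, by simp⟩

theorem IsGInvariant.mem {A : Set (E L)} (hA : IsGInvariant ρ A) (g : G) {x : E L} (hx : x ∈ A) :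
    ρ g x ∈ A := apply_mem_of_image_eq (hA g) hx

theorem IsGInvariant.mem_iff {A : Set (E L)} (hA : IsGInvariant ρ A) (g : G) {x : E L} :
    ρ g x ∈ A ↔ x ∈ A := apply_mem_iff (hA g)

theorem IsGInvariant.inter {A B : Set (E L)} (hA : IsGInvariant ρ A) (hB : IsGInvariant ρ B) :
    IsGInvariant ρ (A ∩ B) := fun g => by
  rw [image_inter (ρ g).injective, hA g, hB g]

/-- Carries compactness of Σ ∩ spt X over to Σ ∩ G·spt X, although Σ need not be closed. -/
theorem IsGInvariant.inter_saturation {A : Set (E L)} (hA : IsGInvariant ρ A) (K : Set (E L)) :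
    A ∩ saturation ρ K = saturation ρ (A ∩ K) := by
  ext x
  constructor
  · rintro ⟨hx, g, hg⟩
    exact ⟨g, hA.mem g hx, hg⟩
  · rintro ⟨g, hg, hg'⟩
    exact ⟨(hA.mem_iff g).1 hg, g, hg'⟩

theorem saturation_subset {A K : Set (E L)} (hA : IsGInvariant ρ A) (hK : K ⊆ A) :
    saturation ρ K ⊆ A := by
  rintro x ⟨g, hg⟩
  exact (hA.mem_iff g).1 (hK hg)

variable [TopologicalSpace G]

theorem continuous_isomCLM (hρ : ∀ x : E L, Continuous fun g : G => ρ g x) :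
    Continuous fun g => isomCLM (ρ g) := continuous_clm_apply.2 hρ

theorem continuous_act (hρ : ∀ x : E L, Continuous fun g : G => ρ g x) :
    Continuous fun z : G × E L => ρ z.1 z.2 :=
  ((continuous_isomCLM hρ).comp continuous_fst).clm_apply continuous_snd

section saturation

variable [CompactSpace G]

theorem isCompact_saturation (hρ : ∀ x : E L, Continuous fun g : G => ρ g x) {K : Set (E L)}
    (hK : IsCompact K) : IsCompact (saturation ρ K) := by
  have : saturation ρ K = (fun z : G × E L => ρ z.1 z.2) '' (univ ×ˢ K) := by
    ext x
    constructor
    · rintro ⟨g, hg⟩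
      exact ⟨(g⁻¹, ρ g x), ⟨mem_univ _, hg⟩, by simp⟩
    · rintro ⟨⟨g, y⟩, ⟨-, hy⟩, rfl⟩
      exact ⟨g⁻¹, by simpa using hy⟩
  rw [this]
  exact (isCompact_univ.prod hK).image (continuous_act hρ)

theorem isClosed_saturation (hρ : ∀ x : E L, Continuous fun g : G => ρ g x) {K : Set (E L)}
    (hK : IsClosed K) : IsClosed (saturation ρ K) := by
  have : saturation ρ K = Prod.snd '' ((fun z : G × E L => ρ z.1 z.2) ⁻¹' K) := by
    ext x
    constructor
    · rintro ⟨g, hg⟩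
      exact ⟨(g, x), hg, rfl⟩
    · rintro ⟨⟨g, y⟩, hy, rfl⟩
      exact ⟨g, hy⟩
  rw [this]
  exact isClosedMap_snd_of_compactSpace _ (hK.preimage (continuous_act hρ))

end saturation

variable [MeasurableSpace G]

/-- The average `∫ g_* X dg` of a vector field over the group. -/
noncomputable def avgField (μ : Measure G) (ρ : G →* (E L ≃ₗᵢ[ℝ] E L)) (X : E L → E L) (x : E L) :
    E L := ∫ g, ρ g (X (ρ g⁻¹ x)) ∂μ

/-- The average of a function over the group. -/
noncomputable def avgFun (μ : Measure G) (ρ : G →* (E L ≃ₗᵢ[ℝ] E L)) (f : E L → ℝ) (x : E L) :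
    ℝ := ∫ g, f (ρ g⁻¹ x) ∂μ

variable [IsTopologicalGroup G] [CompactSpace G] [BorelSpace G] {μ : Measure G}

theorem continuous_invAct (hρ : ∀ x : E L, Continuous fun g : G => ρ g x) :
    Continuous (invAct ρ) := (continuous_isomCLM hρ).comp continuous_inv

section finite

variable [IsFiniteMeasure μ]

theorem contDiff_avgField (hρ : ∀ x : E L, Continuous fun g : G => ρ g x) {X : E L → E L}
    (hX : ContDiff ℝ ∞ X) : ContDiff ℝ ∞ (avgField μ ρ X) :=
  contDiff_integral_comp (R := invAct ρ) (continuous_invAct hρ) (continuous_isomCLM hρ) hX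

theorem contDiff_avgFun (hρ : ∀ x : E L, Continuous fun g : G => ρ g x) {f : E L → ℝ}
    (hf : ContDiff ℝ ∞ f) : ContDiff ℝ ∞ (avgFun μ ρ f) :=
  contDiff_integral_comp (R := invAct ρ) (A := fun _ => ContinuousLinearMap.id ℝ ℝ)
    (continuous_invAct hρ) continuous_const hf

theorem fderiv_avgField (hρ : ∀ x : E L, Continuous fun g : G => ρ g x) {X : E L → E L}
    (hX : ContDiff ℝ ∞ X) (x : E L) : fderiv ℝ (avgField μ ρ X) x =
      ∫ g, isomCLM (ρ g) ∘L fderiv ℝ X (ρ g⁻¹ x) ∘L invAct ρ g ∂μ :=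
  (hasFDerivAt_integral_comp (R := invAct ρ) (continuous_invAct hρ) (continuous_isomCLM hρ)
    (hX.of_le (by simp)) x).fderiv

theorem fderiv_avgFun (hρ : ∀ x : E L, Continuous fun g : G => ρ g x) {f : E L → ℝ}
    (hf : ContDiff ℝ ∞ f) (x : E L) : fderiv ℝ (avgFun μ ρ f) x =
      ∫ g, fderiv ℝ f (ρ g⁻¹ x) ∘L invAct ρ g ∂μ :=
  (hasFDerivAt_integral_comp (R := invAct ρ) (A := fun _ => ContinuousLinearMap.id ℝ ℝ)
    (continuous_invAct hρ) continuous_const (hf.of_le (by simp)) x).fderiv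

theorem integrable_avgField (hρ : ∀ x : E L, Continuous fun g : G => ρ g x) {X : E L → E L}
    (hX : Continuous X) (x : E L) : Integrable (fun g => ρ g (X (ρ g⁻¹ x))) μ :=
  integrable_of_continuous ((continuous_isomCLM hρ).clm_apply
    (hX.comp ((continuous_invAct hρ).clm_apply continuous_const)))

end finite

/-- Substitute g ↦ hg and use left invariance of the measure. -/
theorem avgField_apply [μ.IsMulLeftInvariant] (X : E L → E L) (h : G) (x : E L) :
    avgField μ ρ X (ρ h x) = ρ h (avgField μ ρ X x) := by
  unfold avgField
  rw [← integral_mul_left_eq_self _ h]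
  have : (fun g => ρ (h * g) (X (ρ (h * g)⁻¹ (ρ h x)))) =
      fun g => (ρ h).toContinuousLinearEquiv (ρ g (X (ρ g⁻¹ x))) := by
    ext1 g
    simp only [mul_inv_rev, rho_mul_apply, rho_inv_apply_rho_apply]
    rfl
  rw [this, ContinuousLinearEquiv.integral_comp_comm]
  rfl

theorem avgFun_apply [μ.IsMulLeftInvariant] (f : E L → ℝ) (h : G) (x : E L) :
    avgFun μ ρ f (ρ h x) = avgFun μ ρ f x := by
  unfold avgFun
  rw [← integral_mul_left_eq_self _ h]
  simp only [mul_inv_rev, rho_mul_apply, rho_inv_apply_rho_apply]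

section setIntegral

variable [IsProbabilityMeasure μ] {m : Measure (E L)} {K : Set (E L)} {F : E L → ℝ}

theorem integrable_prod_comp_invAct (hρ : ∀ x : E L, Continuous fun g : G => ρ g x)
    (hK : IsCompact K) (hKG : IsGInvariant ρ K) (hmK : m K < ⊤) (hF : ContinuousOn F K) :
    Integrable (Function.uncurry fun (x : E L) (g : G) => F (ρ g⁻¹ x))
      ((m.restrict K).prod μ) := by
  have : IsFiniteMeasure (m.restrict K) := ⟨by simpa using hmK⟩
  have hmem : ∀ᵐ z ∂((m.restrict K).prod μ), z ∈ K ×ˢ (univ : Set G) := by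
    filter_upwards [Measure.quasiMeasurePreserving_fst.ae (ae_restrict_mem hK.measurableSet)]
      with z hz using ⟨hz, mem_univ _⟩
  have hc : ContinuousOn (Function.uncurry fun (x : E L) (g : G) => F (ρ g⁻¹ x))
      (K ×ˢ (univ : Set G)) :=
    hF.comp (((continuous_invAct hρ).comp continuous_snd).clm_apply continuous_fst).continuousOn
      fun z hz => hKG.mem _ hz.1
  obtain ⟨C, hC⟩ := hK.exists_bound_of_continuousOn hF
  refine Integrable.of_bound ?_ C ?_
  · have := hc.aestronglyMeasurable (μ := (m.restrict K).prod μ)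
      (hK.measurableSet.prod MeasurableSet.univ)
    rwa [Measure.restrict_eq_self_of_ae_mem hmem] at this
  · filter_upwards [hmem] with z hz using hC _ (hKG.mem _ hz.1)

theorem integrableOn_avgFun (hρ : ∀ x : E L, Continuous fun g : G => ρ g x)
    (hK : IsCompact K) (hKG : IsGInvariant ρ K) (hmK : m K < ⊤) (hF : ContinuousOn F K) :
    IntegrableOn (avgFun μ ρ F) K m :=
  have : IsFiniteMeasure (m.restrict K) := ⟨by simpa using hmK⟩
  (integrable_prod_comp_invAct hρ hK hKG hmK hF).integral_prod_left

/-- After Fubini every group element contributes the same integral, since both m and K are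
invariant. -/
theorem setIntegral_avgFun (hρ : ∀ x : E L, Continuous fun g : G => ρ g x)
    (hK : IsCompact K) (hKG : IsGInvariant ρ K) (hmK : m K < ⊤)
    (hm : ∀ g, MeasurePreserving (ρ g) m m) (hF : ContinuousOn F K) :
    ∫ x in K, avgFun μ ρ F x ∂m = ∫ x in K, F x ∂m := by
  have : IsFiniteMeasure (m.restrict K) := ⟨by simpa using hmK⟩
  have h1 := integral_integral_swap (integrable_prod_comp_invAct (μ := μ) hρ hK hKG hmK hF)
  have h2 (g : G) : ∫ x in K, F (ρ g⁻¹ x) ∂m = ∫ x in K, F x ∂m := by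
    have h3 : ρ g⁻¹ ⁻¹' K = K := by ext x; exact hKG.mem_iff _
    have := (hm g⁻¹).setIntegral_preimage_emb
      (ρ g⁻¹).toHomeomorph.measurableEmbedding F K
    rwa [h3] at this
  calc ∫ x in K, avgFun μ ρ F x ∂m = ∫ g, ∫ x in K, F (ρ g⁻¹ x) ∂m ∂μ := h1
    _ = ∫ x in K, F x ∂m := by simp only [h2, integral_const, probReal_univ, one_smul]

end setIntegral

/-! ### Averages of admissible fields -/

section admissible

variable [IsProbabilityMeasure μ] {k : ℕ} {M dM U S dS : Set (E L)} {X : E L → E L}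

theorem avgField_mem_tangentSp (hρ : ∀ x : E L, Continuous fun g : G => ρ g x) (hX : Continuous X)
    {A : Set (E L)} (hA : IsGInvariant ρ A) {p : E L}
    (h : ∀ g, X (ρ g⁻¹ p) ∈ tangentSp A (ρ g⁻¹ p)) : avgField μ ρ X p ∈ tangentSp A p := by
  refine (tangentSp A p).convex.integral_mem (Submodule.closed_of_finiteDimensional _)
    (Eventually.of_forall fun g => ?_) (integrable_avgField hρ hX p)
  have := apply_mem_tangentSp (hA g) (h g)
  rwa [rho_apply_rho_inv_apply] at this

theorem IsAdmissibleField.avgField (hρ : ∀ x : E L, Continuous fun g : G => ρ g x)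
    (hM : IsGInvariant ρ M) (hdM : IsGInvariant ρ dM) (hdS : IsGInvariant ρ dS)
    (hX : IsAdmissibleField M dM dS X) :
    IsAdmissibleField M dM dS (avgField μ ρ X) := by
  refine ⟨contDiff_avgField hρ hX.smooth, fun p hp => ?_, ?_⟩
  · exact avgField_mem_tangentSp hρ hX.smooth.continuous hM fun g => hX.tangent _ (hM.mem _ hp)
  · obtain ⟨W, hW, hdSW, hWX⟩ := hX.tangent_boundary
    -- This set is the intersection of all translates of W. It is open because projection along the
    -- compact factor G is a closed map.
    refine ⟨(saturation ρ Wᶜ)ᶜ, (isClosed_saturation hρ hW.isClosed_compl).isOpen_compl, ?_, ?_⟩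
    · rintro p hp ⟨g, hg⟩
      exact hg (hdSW (hdS.mem g hp))
    · rintro q ⟨hq, hqM⟩
      refine avgField_mem_tangentSp hρ hX.smooth.continuous hdM fun g =>
        hWX _ ⟨?_, hdM.mem _ hqM⟩
      by_contra hn
      exact hq ⟨g⁻¹, hn⟩

theorem IsAdmissibleField.smul (hX : IsAdmissibleField M dM dS X) {f : E L → ℝ}
    (hf : ContDiff ℝ ∞ f) : IsAdmissibleField M dM dS (fun p => f p • X p) := by
  obtain ⟨W, hW, hdSW, hWX⟩ := hX.tangent_boundary
  exact ⟨hf.smul hX.smooth, fun p hp => Submodule.smul_mem _ _ (hX.tangent p hp),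
    W, hW, hdSW, fun q hq => Submodule.smul_mem _ _ (hWX q hq)⟩

theorem avgField_ne_zero (hM : IsGInvariant ρ M) {p : E L} (hp : p ∈ M)
    (h : avgField μ ρ X p ≠ 0) : p ∈ saturation ρ (supportIn M X) := by
  by_contra hn
  refine h ?_
  have : ∀ g, ρ g (X (ρ g⁻¹ p)) = 0 := by
    intro g
    have h0 : X (ρ g⁻¹ p) = 0 := by
      by_contra h0
      exact hn ⟨g⁻¹, subset_closure ⟨hM.mem _ hp, h0⟩⟩
    rw [h0, map_zero]
  simp only [EquivariantStability.avgField, this, integral_zero]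

/-- The saturation of the support is compact since G is, and it stays in U since U is invariant. -/
theorem HasCompactSupportIn.of_saturation (hρ : ∀ x : E L, Continuous fun g : G => ρ g x)
    (hU : IsGInvariant ρ U) (hS : IsGInvariant ρ S) (hX : HasCompactSupportIn M U S X)
    {X' : E L → E L} (hX' : ∀ p ∈ M, X' p ≠ 0 → p ∈ saturation ρ (supportIn M X)) :
    HasCompactSupportIn M U S X' := by
  have hc := isCompact_saturation hρ hX.compact
  have hsub : supportIn M X' ⊆ saturation ρ (supportIn M X) :=
    closure_minimal (fun p hp => hX' p hp.1 hp.2) hc.isClosed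
  refine ⟨hc.of_isClosed_subset isClosed_closure hsub,
    hsub.trans (saturation_subset hU hX.subset), ?_⟩
  have h2 : IsCompact (S ∩ saturation ρ (supportIn M X)) := by
    rw [hS.inter_saturation]
    exact isCompact_saturation hρ hX.compact_inter
  have h3 : S ∩ supportIn M X' = (S ∩ saturation ρ (supportIn M X)) ∩ supportIn M X' := by
    ext x
    exact ⟨fun h => ⟨⟨h.1, hsub h.2⟩, h.2⟩, fun h => ⟨h.1.1, h.2⟩⟩
  rw [h3]
  exact h2.inter_right isClosed_closure

end admissible

end average

/-! ### Localising the integrals to compact sets -/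

section reduction

variable {L k : ℕ} {S K : Set (E L)}

theorem tangentialDeriv_eq_zero {W : Type*} [NormedAddCommGroup W] [NormedSpace ℝ W]
    {F : E L → W} (hK : IsClosed K) (h0 : ∀ p ∈ S, p ∉ K → F p = 0) {p : E L} (hp : p ∈ S)
    (hpK : p ∉ K) : tangentialDeriv S F p = 0 := by
  have : F =ᶠ[𝓝[S] p] fun _ => (0 : W) := by
    filter_upwards [self_mem_nhdsWithin,
      mem_nhdsWithin_of_mem_nhds (hK.isOpen_compl.mem_nhds hpK)] with q hq hq' using h0 q hq hq'
  rw [tangentialDeriv_congr_nhds hp this]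
  simp [tangentialDeriv]

theorem _root_.ContDiff.tangentialDeriv_eq {W : Type*} [NormedAddCommGroup W] [NormedSpace ℝ W]
    {F : E L → W} (hF : ContDiff ℝ ∞ F) {p : E L} :
    tangentialDeriv S F p = fderiv ℝ F p ∘L tangentProj S p :=
  tangentialDeriv_eq_of_hasFDerivWithinAt
    ((hF.differentiable (by simp)) p).hasFDerivAt.hasFDerivWithinAt

theorem setIntegral_eq_of_zero_off {m : Measure (E L)} (hS : MeasurableSet S) (hKS : K ⊆ S)
    {F : E L → ℝ} (h0 : ∀ p ∈ S, p ∉ K → F p = 0) : ∫ p in S, F p ∂m = ∫ p in K, F p ∂m :=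
  setIntegral_eq_of_subset_of_forall_sdiff_eq_zero hS hKS fun p hp => h0 p hp.1 hp.2

theorem surfaceDiv_eq_zero {X : E L → E L} (hX : ContDiff ℝ ∞ X) (hK : IsClosed K)
    (h0 : ∀ p ∈ S, p ∉ K → X p = 0) {p : E L} (hp : p ∈ S) (hpK : p ∉ K) :
    surfaceDiv S X p = 0 := by
  rw [surfaceDiv_eq_clmTrace, ← hX.tangentialDeriv_eq, tangentialDeriv_eq_zero hK h0 hp hpK,
    map_zero]

theorem IsSmoothPiece.continuousOn_surfaceDiv (hS : IsSmoothPiece k S) {X : E L → E L}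
    (hX : ContDiff ℝ ∞ X) : ContinuousOn (surfaceDiv S X) S :=
  ((clmTrace L).continuous.comp_continuousOn
    ((hX.continuous_fderiv (by simp)).continuousOn.clm_comp
      hS.smoothAlong_tangentProj.continuousOn)).congr fun p _ => surfaceDiv_eq_clmTrace S X p

theorem integrableOn_of_continuousOn {m : Measure (E L)} (hK : IsCompact K) (hm : m K < ⊤)
    {F : E L → ℝ} (hF : ContinuousOn F K) : IntegrableOn F K m := by
  have : IsFiniteMeasure (m.restrict K) := ⟨by simpa using hm⟩
  obtain ⟨C, hC⟩ := hK.exists_bound_of_continuousOn hF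
  exact Integrable.of_bound (hF.aestronglyMeasurable hK.measurableSet) C
    ((ae_restrict_mem hK.measurableSet).mono hC)

theorem measurePreserving_isometry (φ : E L ≃ₗᵢ[ℝ] E L) (d : ℕ) :
    MeasurePreserving φ (μHE[d] : Measure (E L)) μHE[d] :=
  φ.toIsometryEquiv.measurePreserving_euclideanHausdorffMeasure d

theorem eq_zero_of_notMem_supportIn {M : Set (E L)} {X : E L → E L} {p : E L} (hp : p ∈ M)
    (h : p ∉ supportIn M X) : X p = 0 := by
  by_contra hne
  exact h (subset_closure ⟨hp, hne⟩)

end reduction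

/-! ### Invariance of the first variation under averaging -/

section firstVariation

variable {L n : ℕ} {G : Type*} [Group G] [TopologicalSpace G] [IsTopologicalGroup G]
  [CompactSpace G] [MeasurableSpace G] [BorelSpace G] {μ : Measure G} [IsProbabilityMeasure μ]
  {ρ : G →* (E L ≃ₗᵢ[ℝ] E L)} {M U S : Set (E L)} {X : E L → E L}

/-- Differentiate under the integral sign. The divergence is tr(DX ∘ P), and conjugation by ρ g
moves the projection from ρ g⁻¹ p to p without changing the trace. -/
theorem surfaceDiv_avgField (hρ : ∀ x : E L, Continuous fun g : G => ρ g x)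
    (hSG : IsGInvariant ρ S) (hX : ContDiff ℝ ∞ X) (p : E L) :
    surfaceDiv S (avgField μ ρ X) p = avgFun μ ρ (surfaceDiv S X) p := by
  have hint : Integrable (fun g => isomCLM (ρ g) ∘L fderiv ℝ X (ρ g⁻¹ p) ∘L invAct ρ g) μ :=
    integrable_of_continuous ((continuous_isomCLM hρ).clm_comp
      (((hX.continuous_fderiv (by simp)).comp
        ((continuous_invAct hρ).clm_apply continuous_const)).clm_comp (continuous_invAct hρ)))
  let T : (E L →L[ℝ] E L) →L[ℝ] ℝ :=
    clmTrace L ∘L ((ContinuousLinearMap.compL ℝ (E L) (E L) (E L)).flip (tangentProj S p))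
  have h1 : surfaceDiv S (avgField μ ρ X) p = T (fderiv ℝ (avgField μ ρ X) p) :=
    surfaceDiv_eq_clmTrace _ _ _
  rw [h1, fderiv_avgField hρ hX, ← T.integral_comp_comm hint]
  refine integral_congr_ae (Eventually.of_forall fun g => ?_)
  dsimp only
  rw [surfaceDiv_eq_clmTrace, ← clmTrace_conj (ρ g), ← conjCLM_comp, ← tangentProj_conj (hSG g),
    rho_apply_rho_inv_apply]
  change clmTrace L ((isomCLM (ρ g) ∘L fderiv ℝ X (ρ g⁻¹ p) ∘L invAct ρ g) ∘L tangentProj S p) = _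
  congr 2
  ext1 v
  simp
  rfl

theorem firstVariation_avgField (hρ : ∀ x : E L, Continuous fun g : G => ρ g x)
    (hS : IsSmoothPiece n S) (hSM : S ⊆ M) (hMG : IsGInvariant ρ M) (hSG : IsGInvariant ρ S)
    (hX : ContDiff ℝ ∞ X) (hXc : HasCompactSupportIn M U S X) :
    firstVariation n S (avgField μ ρ X) = firstVariation n S X := by
  set K := S ∩ saturation ρ (supportIn M X) with hKdef
  have hK : IsCompact K := by
    rw [hKdef, hSG.inter_saturation]
    exact isCompact_saturation hρ hXc.compact_inter
  have hKG : IsGInvariant ρ K := hSG.inter (saturation_invariant _)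
  have hKS : K ⊆ S := inter_subset_left
  have h0 : ∀ p ∈ S, p ∉ K → X p = 0 := fun p hp hpK =>
    eq_zero_of_notMem_supportIn (hSM hp) fun h => hpK ⟨hp, 1, by simpa using h⟩
  have h0' : ∀ p ∈ S, p ∉ K → avgField μ ρ X p = 0 := fun p hp hpK => by
    by_contra hne
    exact hpK ⟨hp, avgField_ne_zero hMG (hSM hp) hne⟩
  rw [firstVariation, firstVariation,
    setIntegral_eq_of_zero_off hS.measurableSet hKS fun p hp hpK =>
      surfaceDiv_eq_zero hX hK.isClosed h0 hp hpK,
    setIntegral_eq_of_zero_off hS.measurableSet hKS fun p hp hpK =>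
      surfaceDiv_eq_zero (contDiff_avgField hρ hX) hK.isClosed h0' hp hpK]
  simp only [surfaceDiv_avgField hρ hSG hX]
  exact setIntegral_avgFun hρ hK hKG (hS.measure_lt_top hK hKS)
    (fun g => measurePreserving_isometry _ _) ((hS.continuousOn_surfaceDiv hX).mono hKS)

end firstVariation

/-! ### Regularised square roots of averaged squares -/

section regularised

variable {L n : ℕ} {G : Type*} [Group G] [TopologicalSpace G] [IsTopologicalGroup G]
  [CompactSpace G] [MeasurableSpace G] [BorelSpace G]

/-- The function `√(∫ (f ∘ g)² dg + ε²) - ε`. -/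
noncomputable def regSqrt (μ : Measure G) (ρ : G →* (E L ≃ₗᵢ[ℝ] E L)) (f : E L → ℝ) (ε : ℝ)
    (p : E L) : ℝ := √(avgFun μ ρ (fun q => f q ^ 2) p + ε ^ 2) - ε

variable {μ : Measure G} {ρ : G →* (E L ≃ₗᵢ[ℝ] E L)} {S : Set (E L)} {f : E L → ℝ} {ε : ℝ}

theorem avgFun_sq_nonneg (p : E L) : 0 ≤ avgFun μ ρ (fun q => f q ^ 2) p :=
  integral_nonneg fun _ => sq_nonneg _

/-- This is (u + ε)² = r + ε². The defect r - u² is 2εu, so it is linear in ε up to the factor u ≤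
√r. -/
theorem regSqrt_sq (p : E L) : regSqrt μ ρ f ε p ^ 2 =
    avgFun μ ρ (fun q => f q ^ 2) p - 2 * ε * regSqrt μ ρ f ε p := by
  have := Real.sq_sqrt (add_nonneg (avgFun_sq_nonneg (μ := μ) (ρ := ρ) (f := f) p) (sq_nonneg ε))
  unfold regSqrt
  linear_combination this

theorem regSqrt_nonneg (p : E L) : 0 ≤ regSqrt μ ρ f ε p := by
  refine sub_nonneg.2 (Real.le_sqrt_of_sq_le ?_)
  linarith [avgFun_sq_nonneg (μ := μ) (ρ := ρ) (f := f) p]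

theorem regSqrt_le (hε : 0 < ε) (p : E L) :
    regSqrt μ ρ f ε p ≤ √(avgFun μ ρ (fun q => f q ^ 2) p) := by
  refine Real.le_sqrt_of_sq_le ?_
  rw [regSqrt_sq]
  have := mul_nonneg (mul_nonneg two_pos.le hε.le) (regSqrt_nonneg (μ := μ) (ρ := ρ) (f := f) (ε := ε) p)
  linarith

variable [IsProbabilityMeasure μ]

theorem contDiff_sqrt_avgFun (hρ : ∀ x : E L, Continuous fun g : G => ρ g x)
    (hf : ContDiff ℝ ∞ f) (hε : 0 < ε) :
    ContDiff ℝ ∞ fun p => √(avgFun μ ρ (fun q => f q ^ 2) p + ε ^ 2) :=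
  ((contDiff_avgFun hρ (hf.pow 2)).add contDiff_const).sqrt fun p =>
    (add_pos_of_nonneg_of_pos (avgFun_sq_nonneg p) (pow_pos hε 2)).ne'

theorem contDiff_regSqrt (hρ : ∀ x : E L, Continuous fun g : G => ρ g x)
    (hf : ContDiff ℝ ∞ f) (hε : 0 < ε) : ContDiff ℝ ∞ (regSqrt μ ρ f ε) :=
  (contDiff_sqrt_avgFun hρ hf hε).sub contDiff_const

theorem norm_fderiv_comp_invAct (hSG : IsGInvariant ρ S) (T : E L → E L →L[ℝ] ℝ) (g : G)
    (p : E L) : ‖T (ρ g⁻¹ p) ∘L invAct ρ g ∘L tangentProj S p‖ =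
      ‖T (ρ g⁻¹ p) ∘L tangentProj S (ρ g⁻¹ p)‖ := by
  have : T (ρ g⁻¹ p) ∘L invAct ρ g ∘L tangentProj S p =
      (T (ρ g⁻¹ p) ∘L tangentProj S (ρ g⁻¹ p)) ∘L invAct ρ g := by
    ext1 v
    exact congrArg (T (ρ g⁻¹ p)) (tangentProj_apply (hSG g⁻¹) p v).symm
  rw [this]
  exact ContinuousLinearMap.opNorm_comp_linearIsometryEquiv _ (ρ g⁻¹)

/-- The Dirichlet density of the regularised square root is at most the averaged one. -/
theorem norm_fderiv_regSqrt_le (hρ : ∀ x : E L, Continuous fun g : G => ρ g x)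
    (hSG : IsGInvariant ρ S) (hf : ContDiff ℝ ∞ f) (hε : 0 < ε) (p : E L) :
    ‖fderiv ℝ (regSqrt μ ρ f ε) p ∘L tangentProj S p‖ ^ 2 ≤
      avgFun μ ρ (fun q => ‖fderiv ℝ f q ∘L tangentProj S q‖ ^ 2) p := by
  set r := avgFun μ ρ (fun q => f q ^ 2) p with hr
  set s := √(r + ε ^ 2) with hs
  have hr0 : 0 ≤ r := avgFun_sq_nonneg p
  have hspos : 0 < s := Real.sqrt_pos.2 (add_pos_of_nonneg_of_pos hr0 (pow_pos hε 2))
  have hs2 : s ^ 2 = r + ε ^ 2 := Real.sq_sqrt (by positivity)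
  have hcq : Continuous fun g => ρ g⁻¹ p := (continuous_invAct hρ).clm_apply continuous_const
  have hcf : Continuous fun g => f (ρ g⁻¹ p) := hf.continuous.comp hcq
  -- `T g` is the tangential derivative of f ∘ g⁻¹ at p.
  let T : G → E L →L[ℝ] ℝ := fun g => fderiv ℝ f (ρ g⁻¹ p) ∘L invAct ρ g ∘L tangentProj S p
  have hcT : Continuous T := ((hf.continuous_fderiv (by simp)).comp hcq).clm_comp
    ((continuous_invAct hρ).clm_comp continuous_const)
  have hDr : fderiv ℝ (avgFun μ ρ fun q => f q ^ 2) p ∘L tangentProj S p =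
      ∫ g, (2 * f (ρ g⁻¹ p)) • T g ∂μ := by
    let C : (E L →L[ℝ] ℝ) →L[ℝ] (E L →L[ℝ] ℝ) :=
      (ContinuousLinearMap.compL ℝ (E L) (E L) ℝ).flip (tangentProj S p)
    have hint : Integrable (fun g => fderiv ℝ (fun q => f q ^ 2) (ρ g⁻¹ p) ∘L invAct ρ g) μ :=
      integrable_of_continuous ((((hf.pow 2).continuous_fderiv (by simp)).comp hcq).clm_comp
        (continuous_invAct hρ))
    change C (fderiv ℝ (avgFun μ ρ fun q => f q ^ 2) p) = _
    rw [fderiv_avgFun hρ (hf.pow 2), ← C.integral_comp_comm hint]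
    refine integral_congr_ae (Eventually.of_forall fun g => ?_)
    have hd : fderiv ℝ (fun q => f q ^ 2) (ρ g⁻¹ p) = (2 * f (ρ g⁻¹ p)) • fderiv ℝ f (ρ g⁻¹ p) := by
      have := ((hf.differentiable (by simp)) (ρ g⁻¹ p)).hasFDerivAt.pow 2
      simpa using this.fderiv
    dsimp only
    rw [hd]
    rfl
  have hDu : fderiv ℝ (regSqrt μ ρ f ε) p ∘L tangentProj S p =
      s⁻¹ • ∫ g, f (ρ g⁻¹ p) • T g ∂μ := by
    have h1 : HasFDerivAt (fun p => avgFun μ ρ (fun q => f q ^ 2) p + ε ^ 2)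
        (fderiv ℝ (avgFun μ ρ fun q => f q ^ 2) p) p :=
      (((contDiff_avgFun hρ (hf.pow 2)).differentiable (by simp)) p).hasFDerivAt.add_const _
    have h2 := (h1.sqrt (add_pos_of_nonneg_of_pos hr0 (pow_pos hε 2)).ne').sub_const ε
    have h3 : fderiv ℝ (regSqrt μ ρ f ε) p =
        (1 / (2 * s)) • fderiv ℝ (avgFun μ ρ fun q => f q ^ 2) p := h2.fderiv
    rw [h3, ContinuousLinearMap.smul_comp, hDr]
    simp only [mul_smul]
    rw [integral_smul, smul_smul]
    congr 1
    field_simp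
  set w := ‖fderiv ℝ (regSqrt μ ρ f ε) p ∘L tangentProj S p‖ with hw
  have hw0 : 0 ≤ w := norm_nonneg _
  have hw1 : w ≤ ∫ g, s⁻¹ * (|f (ρ g⁻¹ p)| * ‖T g‖) ∂μ := by
    rw [hw, hDu, norm_smul, norm_inv, Real.norm_of_nonneg hspos.le, integral_const_mul]
    refine mul_le_mul_of_nonneg_left ?_ (by positivity)
    refine (norm_integral_le_integral_norm _).trans (le_of_eq ?_)
    simp only [norm_smul, Real.norm_eq_abs]
  have hψ : avgFun μ ρ (fun q => ‖fderiv ℝ f q ∘L tangentProj S q‖ ^ 2) p =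
      ∫ g, ‖T g‖ ^ 2 ∂μ := by
    refine integral_congr_ae (Eventually.of_forall fun g => ?_)
    dsimp only [T]
    rw [norm_fderiv_comp_invAct hSG (fderiv ℝ f)]
  rw [hψ]
  -- Cauchy–Schwarz in the form 2ab ≤ a² + b² with a = (w/s)|f ∘ g⁻¹| and b = ‖T g‖. Together with
  -- `hw1` and r ≤ s², integration gives 2w² ≤ w² + ∫ ‖T g‖².
  have hmono : ∫ g, 2 * w * (s⁻¹ * (|f (ρ g⁻¹ p)| * ‖T g‖)) ∂μ ≤
      ∫ g, (w ^ 2 * (s ^ 2)⁻¹ * f (ρ g⁻¹ p) ^ 2 + ‖T g‖ ^ 2) ∂μ := by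
    refine integral_mono (integrable_of_continuous (by fun_prop))
      (integrable_of_continuous (by fun_prop)) fun g => ?_
    have := sq_nonneg (w * s⁻¹ * |f (ρ g⁻¹ p)| - ‖T g‖)
    have h2 := sq_abs (f (ρ g⁻¹ p))
    dsimp only
    rw [← h2, inv_pow s 2 |>.symm]
    nlinarith
  rw [integral_const_mul (2 * w), integral_add (integrable_of_continuous (by fun_prop))
    (integrable_of_continuous (by fun_prop))] at hmono
  have hr' : ∫ g, w ^ 2 * (s ^ 2)⁻¹ * f (ρ g⁻¹ p) ^ 2 ∂μ = w ^ 2 * (s ^ 2)⁻¹ * r :=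
    integral_const_mul _ _
  rw [hr'] at hmono
  have h5 : (s ^ 2)⁻¹ * r ≤ 1 := by
    rw [inv_mul_le_iff₀ (by positivity), hs2]
    nlinarith
  have h6 : w ^ 2 * (s ^ 2)⁻¹ * r ≤ w ^ 2 := by
    rw [mul_assoc]
    exact mul_le_of_le_one_right (sq_nonneg w) h5
  nlinarith

end regularised

/-! ### Invariance properties of the second variation -/

section secondVariation

variable {L n : ℕ} {M dM U S dS K : Set (E L)} {ν : E L → E L}

/-- The potential `Ric(ν, ν) + |A|²` of the second variation. -/
noncomputable def potential (M S : Set (E L)) (ν : E L → E L) (p : E L) : ℝ :=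
  ricci M p (ν p) (ν p) + secondFormNormSq S ν p

/-- The boundary coefficient `h(ν, ν)` of the second variation. -/
noncomputable def boundaryPotential (M dM : Set (E L)) (ν : E L → E L) (p : E L) : ℝ :=
  secondForm dM (inwardUnitNormal M dM) p (ν p) (ν p)

theorem IsUnitNormal.continuousOn_potential (hν : IsUnitNormal M S ν)
    (hM : IsSmoothPiece (n + 1) M) (hS : IsSmoothPiece n S) (hSM : S ⊆ M) :
    ContinuousOn (potential M S ν) S :=
  (hM.continuousOn_ricci hSM hν.smooth.continuousOn).add
    (hS.continuousOn_secondFormNormSq (hν.smoothAlong hM hS hSM))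

theorem IsUnitNormal.continuousOn_boundaryPotential (hν : IsUnitNormal M S ν)
    (hM : IsSubmanifoldWithBoundary (n + 1) M dM) (hdS : dS ⊆ S) (hdM : dS ⊆ dM) :
    ContinuousOn (boundaryPotential M dM ν) dS :=
  hM.isSmoothPiece_boundary.continuousOn_secondForm hM.smoothAlong_inwardUnitNormal hdM
    (hν.smooth.continuousOn.mono hdS)

theorem IsUnitNormal.potential_apply (hν : IsUnitNormal M S ν)
    (hM : IsSmoothPiece (n + 1) M) (hS : IsSmoothPiece n S) (hSM : S ⊆ M)
    {φ : E L ≃ₗᵢ[ℝ] E L} (hφM : φ '' M = M) (hφS : φ '' S = S)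
    (hφν : ∀ q ∈ S, ν (φ q) = φ (ν q)) {p : E L} (hp : p ∈ S) :
    potential M S ν (φ p) = potential M S ν p := by
  rw [potential, potential, secondFormNormSq_conj (hν.smoothAlong hM hS hSM) hφS hφν hp,
    hφν p hp, hM.ricci_conj hφM (hSM hp)]

theorem boundaryPotential_apply (hM : IsSubmanifoldWithBoundary (n + 1) M dM)
    {φ : E L ≃ₗᵢ[ℝ] E L} (hφM : φ '' M = M) {p : E L} (hp : p ∈ dM) (hφν : ν (φ p) = φ (ν p)) :
    boundaryPotential M dM ν (φ p) = boundaryPotential M dM ν p := by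
  rw [boundaryPotential, boundaryPotential, hφν]
  exact secondForm_conj hM.smoothAlong_inwardUnitNormal (hM.image_boundary hφM)
    (fun q hq => hM.inwardUnitNormal_apply hφM hq) hp _ _

/-- Restricts both integrals to sets that will be compact, where the integrands are continuous, and
replaces the tangential derivative by an ambient one. -/
theorem secondVariation_eq (hS : MeasurableSet S) (hdS : MeasurableSet dS) (hdSS : dS ⊆ S)
    (hK : IsClosed K) (hKS : K ⊆ S) {u : E L → ℝ} (hu : ContDiff ℝ ∞ u)
    (h0 : ∀ p ∈ S, p ∉ K → u p = 0) :
    secondVariation n M dM S dS ν u =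
      (∫ p in K, (‖fderiv ℝ u p ∘L tangentProj S p‖ ^ 2 - potential M S ν p * u p ^ 2)
        ∂(μHE[n] : Measure (E L)))
      - ∫ p in dS ∩ K, boundaryPotential M dM ν p * u p ^ 2
        ∂(μHE[n - 1] : Measure (E L)) := by
  have h1 : ∀ p ∈ S, p ∉ K → ‖fderiv ℝ u p ∘L tangentProj S p‖ ^ 2 -
      potential M S ν p * u p ^ 2 = 0 := fun p hp hpK => by
    rw [← hu.tangentialDeriv_eq, tangentialDeriv_eq_zero hK h0 hp hpK, h0 p hp hpK]
    simp
  have h2 : ∀ p ∈ dS, p ∉ dS ∩ K → boundaryPotential M dM ν p * u p ^ 2 = 0 :=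
    fun p hp hpK => by
      rw [h0 p (hdSS hp) fun h => hpK ⟨hp, h⟩]; simp
  rw [← setIntegral_eq_of_zero_off hS hKS h1,
    ← setIntegral_eq_of_zero_off hdS inter_subset_left h2]
  simp only [secondVariation, potential, boundaryPotential, hu.tangentialDeriv_eq]

theorem secondVariation_congr {f u : E L → ℝ} (hS : MeasurableSet S) (hdS : MeasurableSet dS)
    (hdSS : dS ⊆ S) (h : EqOn f u S) :
    secondVariation n M dM S dS ν f = secondVariation n M dM S dS ν u := by
  unfold secondVariation
  congr 1
  · refine setIntegral_congr_fun hS fun p hp => ?_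
    rw [tangentialDeriv_congr hp h, h hp]
  · refine setIntegral_congr_fun hdS fun p hp => ?_
    rw [h (hdSS hp)]

/-- The second variation does not depend on the choice of the unit normal. -/
theorem secondVariation_normal_congr (hM : IsSubmanifoldWithBoundary (n + 1) M dM)
    (hS : IsSubmanifoldWithBoundary n S dS) (hSM : S ⊆ M) {ν' : E L → E L}
    (hν : IsUnitNormal M S ν) (hν' : IsUnitNormal M S ν') {X : E L → E L}
    (hX : ContDiff ℝ ∞ X) {f f' : E L → ℝ} (hf : ∀ p ∈ S, X p = f p • ν p)
    (hf' : ∀ p ∈ S, X p = f' p • ν' p) :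
    secondVariation n M dM S dS ν' f' = secondVariation n M dM S dS ν f := by
  have hMp := hM.isSmoothPiece
  have hSp := hS.isSmoothPiece
  let c : E L → ℝ := fun p => inner ℝ (ν p) (ν' p)
  have hc : ContinuousOn c S := hν.smooth.continuousOn.inner hν'.smooth.continuousOn
  have hνs := hν.smoothAlong hMp hSp hSM
  have hc1 : ∀ p ∈ S, ν' p = c p • ν p ∧ (c p = 1 ∨ c p = -1) := fun p hp =>
    hν.eq_or_eq_neg hν' hMp hSp hSM hp
  have hfi : ∀ p ∈ S, f p = inner ℝ (X p) (ν p) := fun p hp => by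
    rw [hf p hp, inner_smul_left, real_inner_self_eq_norm_sq, hν.norm_eq p hp]; simp
  have hfs : SmoothAlong S f := SmoothAlong.congr
    ((hX.smoothAlong S).map₂ hνs (Φ := fun x => inner ℝ x.1 x.2)
      (contDiff_fst.inner ℝ contDiff_snd)) hfi
  have hcf : ∀ p ∈ S, f' p = c p * f p := fun p hp => by
    have h1 := (hf p hp).symm.trans (hf' p hp)
    rw [(hc1 p hp).1, smul_smul] at h1
    have hν0 : ν p ≠ 0 := fun h0 => by have := hν.norm_eq p hp; rw [h0] at this; simp at this
    have h2 := smul_left_injective ℝ hν0 h1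
    rw [h2]
    rcases (hc1 p hp).2 with h | h <;> simp [h]
  -- A continuous function with values ±1 is locally constant, so derivatives of f' and ν' only
  -- acquire the factor c, and every term of the second variation contains c².
  have hloc : ∀ p ∈ S, ∀ᶠ q in 𝓝[S] p, c q = c p := fun p hp => by
    have h1 : ∀ᶠ q in 𝓝[S] p, |c q - c p| < 1 := by
      have := Metric.tendsto_nhds.1 (hc p hp) 1 one_pos
      simpa only [Real.dist_eq] using this
    filter_upwards [h1, self_mem_nhdsWithin] with q hq hqS
    rcases (hc1 p hp).2 with h | h <;> rcases (hc1 q hqS).2 with h' | h' <;>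
      rw [h, h'] at hq ⊢ <;> norm_num at hq
  have hsq : ∀ p ∈ S, c p ^ 2 = 1 := fun p hp => by
    rcases (hc1 p hp).2 with h | h <;> simp [h]
  have hDf : ∀ p ∈ S, tangentialDeriv S f' p = c p • tangentialDeriv S f p := fun p hp => by
    have h1 : f' =ᶠ[𝓝[S] p] fun q => (c p • ContinuousLinearMap.id ℝ ℝ) (f q) := by
      filter_upwards [hloc p hp, self_mem_nhdsWithin] with q hq hqS
      rw [hcf q hqS, hq]; simp
    rw [tangentialDeriv_congr_nhds hp h1, hfs.tangentialDeriv_clm _ hp]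
    ext; simp
  have hDν : ∀ p ∈ S, tangentialDeriv S ν' p = c p • tangentialDeriv S ν p := fun p hp => by
    have h1 : ν' =ᶠ[𝓝[S] p] fun q => (c p • ContinuousLinearMap.id ℝ (E L)) (ν q) := by
      filter_upwards [hloc p hp, self_mem_nhdsWithin] with q hq hqS
      rw [(hc1 q hqS).1, hq]; simp
    rw [tangentialDeriv_congr_nhds hp h1, hνs.tangentialDeriv_clm _ hp]
    rfl
  have hA : ∀ p ∈ S, secondFormNormSq S ν' p = secondFormNormSq S ν p := fun p hp => by
    unfold secondFormNormSq secondForm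
    simp only [hDν p hp, _root_.smul_apply, inner_smul_left, neg_sq, mul_pow]
    simp [hsq p hp]
  have hR : ∀ p ∈ S, ricci M p (ν' p) (ν' p) = ricci M p (ν p) (ν p) := fun p hp => by
    rw [(hc1 p hp).1]
    rcases (hc1 p hp).2 with h | h
    · simp [h]
    · rw [h, neg_one_smul, hMp.ricci_neg (hSM hp)]
  unfold secondVariation
  congr 1
  · refine setIntegral_congr_fun hSp.measurableSet fun p hp => ?_
    rw [hDf p hp, hA p hp, hR p hp, hcf p hp, norm_smul, mul_pow, mul_pow, Real.norm_eq_abs,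
      sq_abs, hsq p hp, one_mul, one_mul]
  · refine setIntegral_congr_fun hS.isSmoothPiece_boundary.measurableSet fun p hp => ?_
    have hpS := hS.boundary_subset hp
    rw [hcf p hpS, (hc1 p hpS).1, mul_pow, hsq p hpS, one_mul]
    rcases (hc1 p hpS).2 with h | h <;> simp [h, secondForm]

end secondVariation

/-! ### From invariant test fields to arbitrary ones -/

section stability

variable {L n : ℕ} {G : Type*} [Group G] [TopologicalSpace G] [IsTopologicalGroup G]
  [CompactSpace G] [MeasurableSpace G] [BorelSpace G] {μ : Measure G} [IsProbabilityMeasure μ]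
  {ρ : G →* (E L ≃ₗᵢ[ℝ] E L)} {M dM U S dS K : Set (E L)}

theorem avgFun_add_mul {V : E L → ℝ} {A : Set (E L)} (hA : IsGInvariant ρ A)
    (hρ : ∀ x : E L, Continuous fun g : G => ρ g x)
    (hV : ∀ g, ∀ p ∈ A, V (ρ g p) = V p) {ψ w : E L → ℝ} (hψ : ContinuousOn ψ A)
    (hw : ContinuousOn w A) {p : E L} (hp : p ∈ A) :
    avgFun μ ρ (fun q => ψ q - V q * w q) p = avgFun μ ρ ψ p - V p * avgFun μ ρ w p := by
  have hc : Continuous fun g => ρ g⁻¹ p := (continuous_invAct hρ).clm_apply continuous_const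
  have h1 : Continuous fun g => ψ (ρ g⁻¹ p) := hψ.comp_continuous hc fun g => hA.mem _ hp
  have h2 : Continuous fun g => w (ρ g⁻¹ p) := hw.comp_continuous hc fun g => hA.mem _ hp
  unfold avgFun
  simp only [hV _ p hp]
  rw [integral_sub (integrable_of_continuous h1) ((integrable_of_continuous h2).const_mul _),
    integral_const_mul]

/-- An integral `∫ (ψ - V f²)` bounds from above the corresponding integral for the regularised
square root of the average of `f²`, up to an error that is linear in `ε`. -/
theorem setIntegral_regSqrt_le (hρ : ∀ x : E L, Continuous fun g : G => ρ g x)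
    (hK : IsCompact K) (hKG : IsGInvariant ρ K) {m : Measure (E L)} (hmK : m K < ⊤)
    (hm : ∀ g, MeasurePreserving (ρ g) m m) {V ψ f : E L → ℝ} (hVc : ContinuousOn V K)
    (hV : ∀ g, ∀ p ∈ K, V (ρ g p) = V p) (hψ : ContinuousOn ψ K) (hf : ContDiff ℝ ∞ f) {ε : ℝ}
    (hε : 0 < ε) {ψ' : E L → ℝ} (hψ' : ContinuousOn ψ' K)
    (hle : ∀ p ∈ K, ψ' p ≤ avgFun μ ρ ψ p) :
    ∫ p in K, (ψ' p - V p * regSqrt μ ρ f ε p ^ 2) ∂m ≤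
      ∫ p in K, (ψ p - V p * f p ^ 2) ∂m +
        ε * ∫ p in K, 2 * |V p| * √(avgFun μ ρ (fun q => f q ^ 2) p) ∂m := by
  have hf2 : ContinuousOn (fun q => f q ^ 2) K := (hf.continuous.pow 2).continuousOn
  have hF : ContinuousOn (fun p => ψ p - V p * f p ^ 2) K := hψ.sub (hVc.mul hf2)
  have hu : ContinuousOn (regSqrt μ ρ f ε) K := (contDiff_regSqrt hρ hf hε).continuous.continuousOn
  have hr : Continuous (avgFun μ ρ fun q => f q ^ 2) :=
    (contDiff_avgFun hρ (hf.pow 2)).continuous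
  have hE : ContinuousOn (fun p => 2 * |V p| * √(avgFun μ ρ (fun q => f q ^ 2) p)) K :=
    (continuousOn_const.mul hVc.abs).mul (Real.continuous_sqrt.comp hr).continuousOn
  have hEi := integrableOn_of_continuousOn hK hmK hE
  rw [← setIntegral_avgFun (μ := μ) hρ hK hKG hmK hm hF, ← integral_const_mul,
    ← integral_add (integrableOn_avgFun hρ hK hKG hmK hF) (hEi.const_mul ε)]
  refine setIntegral_mono_on (integrableOn_of_continuousOn hK hmK (hψ'.sub (hVc.mul (hu.pow 2))))
    ((integrableOn_avgFun hρ hK hKG hmK hF).add (hEi.const_mul ε)) hK.measurableSet fun p hp => ?_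
  rw [avgFun_add_mul hKG hρ hV hψ hf2 hp, regSqrt_sq]
  -- Replacing r by u² = r - 2εu costs 2εVu. Since V has no sign, this is bounded by 2ε|V|√r, which
  -- is independent of ε apart from the factor in front.
  have h1 : V p * regSqrt μ ρ f ε p ≤ |V p| * √(avgFun μ ρ (fun q => f q ^ 2) p) :=
    mul_le_mul (le_abs_self _) (regSqrt_le hε p) (regSqrt_nonneg p) (abs_nonneg _)
  have h2 := hle p hp
  have h3 := mul_le_mul_of_nonneg_left h1 hε.le
  linarith

/-- Invariant test fields suffice for the stability inequality of an invariant unit normal. -/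
theorem secondVariation_nonneg (μ : Measure G) [IsProbabilityMeasure μ]
    [μ.IsMulLeftInvariant] (hρ : ∀ x : E L, Continuous fun g : G => ρ g x)
    (hM : IsSubmanifoldWithBoundary (n + 1) M dM) (hMG : IsGInvariant ρ M)
    (hUG : IsGInvariant ρ U) (hUM : U ⊆ M) (hS : IsAlmostProperHypersurface n dM U S dS)
    (hSG : IsGInvariant ρ S) {ν : E L → E L} (hν : IsUnitNormal M S ν) (hνG : IsGField ρ S ν)
    (hst : ∀ (X : E L → E L) (f : E L → ℝ), IsAdmissibleField M dM dS X →
      IsGField ρ Set.univ X → HasCompactSupportIn M U S X → (∀ p ∈ S, X p = f p • ν p) →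
      0 ≤ secondVariation n M dM S dS ν f)
    {X : E L → E L} {f : E L → ℝ} (hX : IsAdmissibleField M dM dS X)
    (hXc : HasCompactSupportIn M U S X) (hXf : ∀ p ∈ S, X p = f p • ν p) :
    0 ≤ secondVariation n M dM S dS ν f := by
  have hSM : S ⊆ M := hS.subset.trans hUM
  have hMp := hM.isSmoothPiece
  have hSp := hS.submanifold.isSmoothPiece
  have hdSp := hS.submanifold.isSmoothPiece_boundary
  have hdSS := hS.submanifold.boundary_subset
  have hdSM : dS ⊆ dM := hS.boundary_subset.trans inter_subset_right
  have hdMG : IsGInvariant ρ dM := fun g => hM.image_boundary (hMG g)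
  have hdSG : IsGInvariant ρ dS := fun g => hS.submanifold.image_boundary (hSG g)
  -- a smooth ambient extension of `f`
  have hfi : ∀ p ∈ S, f p = inner ℝ (X p) (ν p) := fun p hp => by
    rw [hXf p hp, inner_smul_left, real_inner_self_eq_norm_sq, hν.norm_eq p hp]; simp
  have hfs : SmoothAlong S f := SmoothAlong.congr
    ((hX.smooth.smoothAlong S).map₂ (hν.smoothAlong hMp hSp hSM) (Φ := fun x => inner ℝ x.1 x.2)
      (contDiff_fst.inner ℝ contDiff_snd)) hfi
  obtain ⟨φ, hφ, hφf⟩ := hfs.exists_contDiff hXc.compact_inter.isClosed inter_subset_left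
    fun p hp hpK => by
      rw [hfi p hp, eq_zero_of_notMem_supportIn (hSM hp) fun h => hpK ⟨hp, h⟩, inner_zero_left]
  have hXφ : ∀ p ∈ S, X p = φ p • ν p := fun p hp => by rw [hφf hp]; exact hXf p hp
  -- the invariant compact set that carries all integrands
  set K := S ∩ saturation ρ (supportIn M X) with hKdef
  have hKS : K ⊆ S := inter_subset_left
  have hKi : IsCompact (S ∩ saturation ρ (supportIn M X)) := by
    rw [hSG.inter_saturation]
    exact isCompact_saturation hρ hXc.compact_inter
  have hK : IsCompact K := hKi
  have hKG : IsGInvariant ρ K := hSG.inter (saturation_invariant _)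
  have hK' : IsCompact (dS ∩ K) := by
    have : dS ∩ K = dS ∩ saturation ρ (supportIn M X) := by
      rw [hKdef, ← inter_assoc, inter_eq_left.2 hdSS]
    rw [this]
    exact hS.submanifold.isCompact_boundary_inter hKi
  have hφK : ∀ p ∈ S, p ∉ K → ∀ g, φ (ρ g p) = 0 := fun p hp hpK g => by
    have hgp := hSG.mem g hp
    rw [hφf hgp, hfi _ hgp, eq_zero_of_notMem_supportIn (hSM hgp) fun h => hpK ⟨hp, g, h⟩,
      inner_zero_left]
  have hmn := hSp.measure_lt_top hK hKS
  have hmn' := hdSp.measure_lt_top hK' inter_subset_left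
  rw [secondVariation_congr hSp.measurableSet hdSp.measurableSet hdSS hφf.symm,
    secondVariation_eq hSp.measurableSet hdSp.measurableSet hdSS hK.isClosed hKS hφ
      fun p hp hpK => by simpa using hφK p hp hpK 1]
  set r := avgFun μ ρ fun q => φ q ^ 2 with hr
  -- the inequality for the regularised square roots
  have hreg : ∀ ε : ℝ, 0 < ε → 0 ≤ secondVariation n M dM S dS ν (regSqrt μ ρ φ ε) := by
    intro ε hε
    -- On Σ one has φX = φ²ν with ν equivariant, so averaging φX gives rν. Multiplication by c turns
    -- r into √(r + ε²) - ε, because r = (√(r + ε²) - ε)(√(r + ε²) + ε).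
    let Y : E L → E L := avgField μ ρ fun p => φ p • X p
    let c : E L → ℝ := fun p => (√(r p + ε ^ 2) + ε)⁻¹
    have hcpos : ∀ p, √(r p + ε ^ 2) + ε ≠ 0 := fun p =>
      (add_pos_of_nonneg_of_pos (Real.sqrt_nonneg _) hε).ne'
    have hc : ContDiff ℝ ∞ c :=
      ((contDiff_sqrt_avgFun hρ hφ hε).add contDiff_const).inv hcpos
    refine hst (fun p => c p • Y p) _ (((hX.smul hφ).avgField hρ hMG hdMG hdSG).smul hc)
      (fun g p _ => ?_) (hXc.of_saturation hρ hUG hSG fun p hp hne => ?_) fun p hp => ?_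
    · dsimp only [c, Y]
      rw [avgField_apply, hr, avgFun_apply, map_smul]
    · have hY : Y p ≠ 0 := fun h0 => hne (by rw [h0, smul_zero])
      obtain ⟨g, hg⟩ := avgField_ne_zero hMG hp hY
      refine ⟨g, closure_mono ?_ hg⟩
      rintro q ⟨hq, hq'⟩
      exact ⟨hq, fun h0 => hq' (by dsimp only; rw [h0, smul_zero])⟩
    · have hY : Y p = r p • ν p := by
        have : ∀ g, ρ g (φ (ρ g⁻¹ p) • X (ρ g⁻¹ p)) = (φ (ρ g⁻¹ p) ^ 2) • ν p := fun g => by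
          have hgp := hSG.mem g⁻¹ hp
          rw [hXφ _ hgp, smul_smul, map_smul, ← hνG g _ hgp, rho_apply_rho_inv_apply, sq]
        simp only [Y, avgField, this]
        exact integral_smul_const _ _
      rw [hY, smul_smul]
      congr 1
      have h1 := Real.sq_sqrt (add_nonneg (avgFun_sq_nonneg (μ := μ) (ρ := ρ) (f := φ) p)
        (sq_nonneg ε))
      rw [inv_mul_eq_iff_eq_mul₀ (hcpos p), regSqrt, ← hr]
      linear_combination -h1
  -- comparison
  set Q := (∫ p in K, (‖fderiv ℝ φ p ∘L tangentProj S p‖ ^ 2 - potential M S ν p * φ p ^ 2)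
      ∂(μHE[n] : Measure (E L)))
    - ∫ p in dS ∩ K, boundaryPotential M dM ν p * φ p ^ 2 ∂(μHE[n - 1] : Measure (E L)) with hQ
  have hV := hν.continuousOn_potential hMp hSp hSM
  have hVG : ∀ g, ∀ p ∈ K, potential M S ν (ρ g p) = potential M S ν p := fun g p hp =>
    hν.potential_apply hMp hSp hSM (hMG g) (hSG g) (hνG g) (hKS hp)
  have hB := hν.continuousOn_boundaryPotential hM hdSS hdSM
  have hBG : ∀ g, ∀ p ∈ dS ∩ K, boundaryPotential M dM ν (ρ g p) = boundaryPotential M dM ν p :=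
    fun g p hp => boundaryPotential_apply hM (hMG g) (hdSM hp.1) (hνG g p (hKS hp.2))
  have hD : ∀ u : E L → ℝ, ContDiff ℝ ∞ u →
      ContinuousOn (fun p => ‖fderiv ℝ u p ∘L tangentProj S p‖ ^ 2) K := fun u hu =>
    ((((hu.continuous_fderiv (by simp)).continuousOn.clm_comp
      (hSp.smoothAlong_tangentProj.continuousOn)).norm.pow 2).mono hKS)
  set C := (∫ p in K, 2 * |potential M S ν p| * √(r p) ∂(μHE[n] : Measure (E L))) +
    ∫ p in dS ∩ K, 2 * |boundaryPotential M dM ν p| * √(r p) ∂(μHE[n - 1] : Measure (E L)) with hC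
  have hQC : ∀ ε : ℝ, 0 < ε → 0 ≤ Q + ε * C := by
    intro ε hε
    have hu := contDiff_regSqrt (μ := μ) hρ hφ hε
    have h0 := hreg ε hε
    rw [secondVariation_eq hSp.measurableSet hdSp.measurableSet hdSS hK.isClosed hKS hu
      fun p hp hpK => by
        -- Off K the average r vanishes, and the -ε in `regSqrt` then makes the test function vanish
        -- too.
        have : r p = 0 := by
          simp only [hr, avgFun, hφK p hp hpK]; simp
        rw [regSqrt, ← hr, this, zero_add, Real.sqrt_sq hε.le, sub_self]] at h0
    have h1 := setIntegral_regSqrt_le (μ := μ) hρ hK hKG hmn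
      (fun g => measurePreserving_isometry (ρ g) n) (hV.mono hKS) hVG (hD φ hφ) hφ hε (hD _ hu)
      fun p _ => norm_fderiv_regSqrt_le hρ hSG hφ hε p
    -- The boundary term obeys the same estimate with no gradient part.
    have h2 := setIntegral_regSqrt_le (μ := μ) (ψ := fun _ => 0) (ψ' := fun _ => 0)
      hρ hK' (hdSG.inter hKG) hmn' (fun g => measurePreserving_isometry (ρ g) (n - 1))
      (hB.mono inter_subset_left) hBG continuousOn_const hφ hε continuousOn_const
      fun p _ => by simp [avgFun]
    simp only [zero_sub, integral_neg] at h2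
    rw [← hr] at h1 h2
    rw [hQ, hC, mul_add]
    linarith
  by_contra hneg
  rw [not_le] at hneg
  -- If Q < 0, the choice ε = -Q / (2(|C| + 1)) gives εC ≤ -Q/2, hence Q + εC ≤ Q/2 < 0. The summand
  -- 1 keeps the denominator positive.
  have hC1 : 0 < |C| + 1 := by positivity
  have h1 := hQC (-Q / (2 * (|C| + 1))) (div_pos (neg_pos.2 hneg) (by positivity))
  have h2 : -Q / (2 * (|C| + 1)) * C ≤ -Q / (2 * (|C| + 1)) * (|C| + 1) :=
    mul_le_mul_of_nonneg_left ((le_abs_self C).trans (by linarith))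
      (div_pos (neg_pos.2 hneg) (by positivity)).le
  have h3 : -Q / (2 * (|C| + 1)) * (|C| + 1) = -Q / 2 := by field_simp
  linarith

end stability

end EquivariantStability

/-! ### The main theorem -/

theorem mainTheorem12 {L n : ℕ} (hn : 2 ≤ n)
    {G : Type*} [Group G] [TopologicalSpace G] [IsTopologicalGroup G] [CompactSpace G]
    (ρ : G →* (E L ≃ₗᵢ[ℝ] E L)) (hρ : ∀ x : E L, Continuous fun g : G => ρ g x)
    (M dM : Set (E L)) (hM : IsSubmanifoldWithBoundary (n + 1) M dM) (hMc : IsCompact M)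
    (hMG : IsGInvariant ρ M)
    (U : Set (E L)) (hU : ∃ O : Set (E L), IsOpen O ∧ U = M ∩ O) (hUG : IsGInvariant ρ U)
    (S dS : Set (E L)) (hS : IsAlmostProperHypersurface n dM U S dS) (hSG : IsGInvariant ρ S) :
    (GStationaryIn ρ n M dM U S dS ↔ StationaryIn n M dM U S dS) ∧
    (GStableIn ρ n M dM U S dS ↔
      (∃ ν : E L → E L, IsUnitNormal M S ν ∧ IsGField ρ S ν) ∧ StableIn n M dM U S dS) := by
  borelize G
  -- The reference set ⊤ is the whole compact group, so the Haar measure has total mass one.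
  let μ : Measure G := Measure.haarMeasure ⊤
  have hμ : IsProbabilityMeasure μ := ⟨Measure.haarMeasure_self⟩
  have hUM : U ⊆ M := by
    obtain ⟨O, -, rfl⟩ := hU
    exact Set.inter_subset_left
  have hSM : S ⊆ M := hS.subset.trans hUM
  have hdMG : IsGInvariant ρ dM := fun g => hM.image_boundary (hMG g)
  have hdSG : IsGInvariant ρ dS := fun g => hS.submanifold.image_boundary (hSG g)
  have h1 : GStationaryIn ρ n M dM U S dS ↔ StationaryIn n M dM U S dS := by
    refine ⟨fun h X hX hXc => ?_, fun h X hX _ hXc => h X hX hXc⟩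
    rw [← firstVariation_avgField (μ := μ) hρ hS.submanifold.isSmoothPiece hSM hMG hSG hX.smooth hXc]
    exact h _ (hX.avgField hρ hMG hdMG hdSG) (fun g p _ => avgField_apply X g p)
      (hXc.of_saturation hρ hUG hSG fun p hp hne => avgField_ne_zero hMG hp hne)
  refine ⟨h1, ⟨?_, ?_⟩⟩
  · rintro ⟨hst, ν, hν, hνG, hnn⟩
    exact ⟨⟨ν, hν, hνG⟩, h1.1 hst, ν, hν, fun X f hX hXc hXf =>
      secondVariation_nonneg μ hρ hM hMG hUG hUM hS hSG hν hνG hnn hX hXc hXf⟩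
  · rintro ⟨⟨ν, hν, hνG⟩, hst, ν', hν', hnn⟩
    refine ⟨h1.2 hst, ν, hν, hνG, fun X f hX _ hXc hXf => ?_⟩
    -- The normal ν' from stability need not be invariant. The same field X has coefficient ±f with
    -- respect to ν', and its second variation is the same for both normals.
    have hcf : ∀ p ∈ S, X p = (inner ℝ (ν p) (ν' p) * f p) • ν' p := fun p hp => by
      obtain ⟨h2, h3⟩ := hν.eq_or_eq_neg hν' hM.isSmoothPiece hS.submanifold.isSmoothPiece hSM hp
      rw [hXf p hp]
      rcases h3 with h | h <;> rw [h] at h2 ⊢ <;> simp [h2]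
    rw [← secondVariation_normal_congr hM hS.submanifold hSM hν hν' hX.smooth hXf hcf]
    exact hnn X _ hX hXc hcf
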